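/- Let $G$ be a group, let $B_G$ be an Eilenberg–MacLane space for $G$ (a based connected CW complex with $\pi_1(B_G)\cong G$ and $\pi_i(B_G)=0$ for $i\ge 2$), and write $H_*(G)=H_*(B_G)$, $H^*(G)=H^*(B_G)$ (integer coefficients). Let $\alpha\in H_4(G)$. Let $M$ be a closed connected oriented topological 4-manifold with orientation class $[M]\in H_4(M)$, let $\phi\colon\pi_1(M)\to G$ be an isomorphism, let $f\colon M\to B_G$ be a based map inducing $\phi$, and suppose $f_*([M])=\alpha$. The intersection form of $M$ is the form $(x,y)\mapsto (x\cup y)\cap[M]$ on $H^2(M)/\mathrm{torsion}$. Let $I(M,f)\subset H^2(M)/\mathrm{torsion}$ be the image of the composite $H^2(G)\xrightarrow{f^*}H^2(M)\to H^2(M)/\mathrm{torsion}$. For an integral bilinear form $F$ on an abelian group $V$, let $b^+(F)$ (respectively $b^-(F)$) denote the maximal dimension of a real subspace of $V\otimes\mathbb R$ on which $F$ is positive (respectively negative) definite; call $F$ even if $F(v,v)$ is even for all $v\in V$, and call a subgroup $W\subset V$ isotropic for $F$ if $F(w_1,w_2)=0$ for all $w_1,w_2\in W$. Write $b^\pm(M)$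 and $b^\pm(I(M,f))$ for the values of $b^\pm$ on the intersection form of $M$ and on its restriction to $I(M,f)$. Then $f^*\colon H^2(G)\to H^2(M)$ is injective, and the restriction of the intersection form of $M$ to $I(M,f)$ depends only on $G$ and $\alpha$: it is given by the pairing $$H^2(G)\times H^2(G)\to\mathbb Z,\qquad (x,y)\mapsto (x\cup y)\cap\alpha, \tag{1}$$ that is, $(f^*x\cup f^*y)\cap[M]=(x\cup y)\cap\alpha$ for all $x,y\in H^2(G)$, and $f^*$ induces an isomorphism $H^2(G)/\mathrm{torsion}\cong I(M,f)$ that carries the form induced by (1) to the restriction of the intersection form. Moreover: 1. $b^+(M)\ge b^+(I(M,f))$ and $b^-(M)\ge b^-(I(M,f))$. 2. If a subgroup $W\subset H^2(G)$ is isotropic for (1), then its image in $I(M,f)$ is isotropic for the intersection form of $M$. 3. If (1) is even, then the restriction of the intersection form of $M$ to $I(M,f)$ is even. 4. If $I(M,f)=H^2(M)/\mathrm{torsion}$ (for instance, if $f^*\colon H^2(G)\to H^2(M)$ is surjective), then the intersection form of $M$ is determined by $\alpha$: $f^*$ induces an isomorphism from $H^2(G)/\mathrm{torsion}$, with the form induced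 by (1), to $H^2(M)/\mathrm{torsion}$ with the intersection form. -/

import Mathlib

open scoped TensorProduct

noncomputable section

namespace GroupGeography

/-! ### Singular chains and cochains with integer coefficients -/

/-- Singular `n`-simplices of `X`. -/
abbrev Simplex (n : ℕ) (X : Type*) [TopologicalSpace X] : Type _ :=
  C(stdSimplex ℝ (Fin (n + 1)), X)

/-- Precomposition of a singular simplex with the affine map of standard simplices given on
vertices by `v`. -/
def Simplex.pull {m n : ℕ} {X : Type*} [TopologicalSpace X] (v : Fin (m + 1) → Fin (n + 1))
    (s : Simplex n X) : Simplex m X :=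
  s.comp ⟨stdSimplex.map v, stdSimplex.continuous_map v⟩

/-- The `i`-th face of a singular simplex (the one opposite to the vertex `i`). -/
def Simplex.face {n : ℕ} {X : Type*} [TopologicalSpace X] (i : Fin (n + 2))
    (s : Simplex (n + 1) X) : Simplex n X :=
  s.pull i.succAbove

/-- The front `p`-face, spanned by the vertices `0, …, p`. -/
def Simplex.front {p q n : ℕ} (h : p + q = n) {X : Type*} [TopologicalSpace X]
    (s : Simplex n X) : Simplex p X :=
  s.pull fun i => ⟨i, by omega⟩

/-- The back `q`-face, spanned by the vertices `p, …, p + q`. -/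
def Simplex.back {p q n : ℕ} (h : p + q = n) {X : Type*} [TopologicalSpace X]
    (s : Simplex n X) : Simplex q X :=
  s.pull fun i => ⟨p + i, by omega⟩

/-- Singular `n`-chains: finite integral combinations of singular `n`-simplices. -/
abbrev Chain (n : ℕ) (X : Type*) [TopologicalSpace X] : Type _ := Simplex n X →₀ ℤ

/-- Singular `n`-cochains. -/
abbrev Cochain (n : ℕ) (X : Type*) [TopologicalSpace X] : Type _ := Simplex n X → ℤ

/-- `∂ s = ∑ᵢ (-1)ⁱ (i-th face of s)`. -/
def boundary (n : ℕ) (X : Type*) [TopologicalSpace X] : Chain (n + 1) X →ₗ[ℤ] Chain n X :=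
  ∑ i : Fin (n + 2), ((-1) ^ (i : ℕ) : ℤ) • Finsupp.lmapDomain ℤ ℤ (Simplex.face i)

/-- `(δ c)(s) = ∑ᵢ (-1)ⁱ c (i-th face of s)`. -/
def coboundary (n : ℕ) (X : Type*) [TopologicalSpace X] : Cochain n X →ₗ[ℤ] Cochain (n + 1) X where
  toFun c := fun s => ∑ i : Fin (n + 2), (-1) ^ (i : ℕ) * c (s.face i)
  map_add' c d := by
    funext s
    simp [mul_add, Finset.sum_add_distrib]
  map_smul' k c := by
    funext s
    simp only [Pi.smul_apply, smul_eq_mul, RingHom.id_apply, Finset.mul_sum]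
    exact Finset.sum_congr rfl fun i _ => by ring

/-- The linear extension of a cochain to chains. -/
def evalChain {n : ℕ} {X : Type*} [TopologicalSpace X] : Cochain n X →ₗ[ℤ] Chain n X →ₗ[ℤ] ℤ where
  toFun c := Finsupp.linearCombination ℤ c
  map_add' c d := by
    ext s
    simp
  map_smul' k c := by
    ext s
    simp

/-- Chains all of whose simplices lie in `A`. -/
def chainsIn (n : ℕ) {X : Type*} [TopologicalSpace X] (A : Set X) : Submodule ℤ (Chain n X) :=
  Finsupp.supported ℤ ℤ {s : Simplex n X | Set.range s ⊆ A}

/-! ### Homology and cohomology -/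

/-- The cycles; every `0`-chain is one. -/
def cycles : (n : ℕ) → (X : Type*) → [TopologicalSpace X] → Submodule ℤ (Chain n X)
  | 0, _, _ => ⊤
  | n + 1, X, _ => LinearMap.ker (boundary n X)

/-- The cycles relative to `A`: chains whose boundary lies in `A`. -/
def relCycles : (n : ℕ) → {X : Type*} → [TopologicalSpace X] → (A : Set X) →
    Submodule ℤ (Chain n X)
  | 0, _, _, _ => ⊤
  | n + 1, X, _, A => (chainsIn n A).comap (boundary n X)

/-- The cocycles. -/
def cocycles (n : ℕ) (X : Type*) [TopologicalSpace X] : Submodule ℤ (Cochain n X) :=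
  LinearMap.ker (coboundary n X)

/-- The coboundaries; in degree `0` only the zero cochain is one. -/
def coboundaries : (n : ℕ) → (X : Type*) → [TopologicalSpace X] → Submodule ℤ (Cochain n X)
  | 0, _, _ => ⊥
  | n + 1, X, _ => LinearMap.range (coboundary n X)

/-- Integral singular homology `H_n(X)`. -/
abbrev Homology (n : ℕ) (X : Type*) [TopologicalSpace X] : Type _ :=
  cycles n X ⧸ (LinearMap.range (boundary n X)).submoduleOf (cycles n X)

/-- Integral relative singular homology `H_n(X, A)`. -/
abbrev RelHomology (n : ℕ) {X : Type*} [TopologicalSpace X] (A : Set X) : Type _ :=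
  relCycles n A ⧸ (LinearMap.range (boundary n X) ⊔ chainsIn n A).submoduleOf (relCycles n A)

/-- Integral singular cohomology `H^n(X)`. -/
abbrev Cohomology (n : ℕ) (X : Type*) [TopologicalSpace X] : Type _ :=
  cocycles n X ⧸ (coboundaries n X).submoduleOf (cocycles n X)

theorem cycles_le_relCycles (n : ℕ) {X : Type*} [TopologicalSpace X] (A : Set X) :
    cycles n X ≤ relCycles n A := by
  cases n with
  | zero => exact le_rfl
  | succ n =>
    intro c hc
    have hc' : boundary n X c = 0 := hc
    change boundary n X c ∈ chainsIn n A
    rw [hc']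
    exact Submodule.zero_mem _

/-- The map `H_n(X) → H_n(X, A)`. -/
def toRel (n : ℕ) {X : Type*} [TopologicalSpace X] (A : Set X) :
    Homology n X →ₗ[ℤ] RelHomology n A :=
  Submodule.mapQ _ _ (Submodule.inclusion (cycles_le_relCycles n A)) fun _ hc =>
    Submodule.mem_sup_left hc

/-! ### Functoriality -/

section Functoriality

variable {X Y : Type*} [TopologicalSpace X] [TopologicalSpace Y]

/-- The chain map induced by a continuous map. -/
def chainMap (n : ℕ) (f : C(X, Y)) : Chain n X →ₗ[ℤ] Chain n Y :=
  Finsupp.lmapDomain ℤ ℤ fun s : Simplex n X => f.comp s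

/-- The cochain map induced by a continuous map. -/
def cochainMap (n : ℕ) (f : C(X, Y)) : Cochain n Y →ₗ[ℤ] Cochain n X :=
  LinearMap.funLeft ℤ ℤ fun s : Simplex n X => f.comp s

theorem boundary_chainMap (n : ℕ) (f : C(X, Y)) (c : Chain (n + 1) X) :
    boundary n Y (chainMap (n + 1) f c) = chainMap n f (boundary n X c) := by
  suffices h : boundary n Y ∘ₗ chainMap (n + 1) f = chainMap n f ∘ₗ boundary n X from
    LinearMap.congr_fun h c
  refine Finsupp.lhom_ext fun s k => ?_
  simp only [boundary, chainMap, LinearMap.comp_apply, LinearMap.sum_apply, LinearMap.smul_apply,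
    map_sum, map_smul, Finsupp.lmapDomain_apply, Finsupp.mapDomain_single]
  rfl

theorem coboundary_cochainMap (n : ℕ) (f : C(X, Y)) (c : Cochain n Y) :
    coboundary n X (cochainMap n f c) = cochainMap (n + 1) f (coboundary n Y c) := rfl

theorem chainMap_mem_cycles (n : ℕ) (f : C(X, Y)) {c : Chain n X} (hc : c ∈ cycles n X) :
    chainMap n f c ∈ cycles n Y := by
  cases n with
  | zero => exact Submodule.mem_top
  | succ n =>
    have hc' : boundary n X c = 0 := hc
    change boundary n Y _ = 0
    rw [boundary_chainMap, hc', map_zero]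

theorem cochainMap_mem_cocycles (n : ℕ) (f : C(X, Y)) {c : Cochain n Y} (hc : c ∈ cocycles n Y) :
    cochainMap n f c ∈ cocycles n X := by
  have hc' : coboundary n Y c = 0 := hc
  change coboundary n X _ = 0
  rw [coboundary_cochainMap, hc', map_zero]

theorem cochainMap_mem_coboundaries (n : ℕ) (f : C(X, Y)) {c : Cochain n Y}
    (hc : c ∈ coboundaries n Y) : cochainMap n f c ∈ coboundaries n X := by
  cases n with
  | zero =>
    have hc' : c = 0 := hc
    change _ = 0
    rw [hc', map_zero]
  | succ n =>
    obtain ⟨d, rfl⟩ := hc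
    exact ⟨cochainMap n f d, coboundary_cochainMap n f d⟩

/-- The induced map `f_* : H_n(X) → H_n(Y)`. -/
def Homology.map (n : ℕ) (f : C(X, Y)) : Homology n X →ₗ[ℤ] Homology n Y :=
  Submodule.mapQ _ _ ((chainMap n f).restrict fun _ hc => chainMap_mem_cycles n f hc) <| by
    rintro ⟨c, _⟩ ⟨d, hd⟩
    exact ⟨chainMap (n + 1) f d, (boundary_chainMap n f d).trans (congrArg (chainMap n f) hd)⟩

/-- The induced map `f^* : H^n(Y) → H^n(X)`. -/
def Cohomology.map (n : ℕ) (f : C(X, Y)) : Cohomology n Y →ₗ[ℤ] Cohomology n X :=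
  Submodule.mapQ _ _ ((cochainMap n f).restrict fun _ hc => cochainMap_mem_cocycles n f hc)
    fun _ hc => cochainMap_mem_coboundaries n f hc

end Functoriality

/-! ### Evaluation and cup product -/

section Products

variable {X : Type*} [TopologicalSpace X]

theorem evalChain_boundary (n : ℕ) (c : Cochain n X) (d : Chain (n + 1) X) :
    evalChain c (boundary n X d) = evalChain (coboundary n X c) d := by
  suffices h : evalChain c ∘ₗ boundary n X = evalChain (coboundary n X c) from
    LinearMap.congr_fun h d
  refine Finsupp.lhom_ext fun s k => ?_
  simp only [boundary, evalChain, coboundary, LinearMap.comp_apply, LinearMap.sum_apply,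
    LinearMap.smul_apply, map_sum, map_smul, Finsupp.lmapDomain_apply, Finsupp.mapDomain_single,
    LinearMap.coe_mk, AddHom.coe_mk, Finsupp.linearCombination_single, smul_eq_mul, Finset.mul_sum]
  exact Finset.sum_congr rfl fun i _ => by ring

/-- The Kronecker evaluation `H^n(X) × H_n(X) → ℤ`, that is, the cap product `H^n × H_n → H_0`
followed by the augmentation `H_0 → ℤ`; for connected `X` this is `(x, a) ↦ x ∩ a ∈ ℤ`. -/
def capEval (n : ℕ) : Cohomology n X →ₗ[ℤ] Homology n X →ₗ[ℤ] ℤ :=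
  LinearMap.liftQ₂ _ _
    (evalChain.compl₁₂ (cocycles n X).subtype (cycles n X).subtype)
    (by
      rintro ⟨c, _⟩ hc
      rw [LinearMap.mem_ker]
      refine LinearMap.ext fun d => ?_
      change evalChain c d.1 = 0
      cases n with
      | zero =>
        have hc' : c = 0 := hc
        simp [hc']
      | succ n =>
        obtain ⟨b, hb⟩ := hc
        have hb' : coboundary n X b = c := hb
        have hd : boundary n X d.1 = 0 := d.2
        rw [← hb', ← evalChain_boundary, hd, map_zero])
    (by
      rintro ⟨d, _⟩ ⟨b, hb⟩
      have hb' : boundary n X b = d := hb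
      rw [LinearMap.mem_ker]
      refine LinearMap.ext fun c => ?_
      change evalChain c.1 d = 0
      have hc : coboundary n X c.1 = 0 := c.2
      rw [← hb', evalChain_boundary, hc]
      simp)

/-- The cup product of cochains, `(c ∪ d)(s) = c (front face of s) * d (back face of s)`. -/
def cupCochain {p q n : ℕ} (h : p + q = n) : Cochain p X →ₗ[ℤ] Cochain q X →ₗ[ℤ] Cochain n X :=
  LinearMap.mk₂ ℤ (fun c d s => c (s.front h) * d (s.back h))
    (fun _ _ _ => funext fun _ => add_mul _ _ _)
    (fun _ _ _ => funext fun _ => mul_assoc _ _ _)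
    (fun _ _ _ => funext fun _ => mul_add _ _ _)
    (fun _ _ _ => funext fun _ => mul_left_comm _ _ _)

theorem Simplex.pull_pull {l m n : ℕ} (v : Fin (l + 1) → Fin (m + 1))
    (w : Fin (m + 1) → Fin (n + 1)) (s : Simplex n X) : (s.pull w).pull v = s.pull (w ∘ v) := by
  ext x
  exact congrArg s (stdSimplex.map_comp_apply v w x)

theorem coboundary_cup {p q n : ℕ} (h : p + q = n) (c : Cochain p X) (d : Cochain q X) :
    coboundary n X (cupCochain h c d) =
      cupCochain (by omega) (coboundary p X c) d +
        ((-1) ^ p : ℤ) • cupCochain (by omega) c (coboundary q X d) := by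
  subst h
  funext s
  have hp : p + 1 + q = p + q + 1 := by omega
  have hq : p + (q + 1) = p + q + 1 := rfl
  have hpq : p + 1 + (q + 1) = p + q + 2 := by omega
  have front_low (i : Fin (p + 1)) : (s.face (Fin.cast hpq (Fin.castAdd (q + 1) i))).front rfl =
      (s.front hp).face i.castSucc := by
    simp only [Simplex.face, Simplex.front, Simplex.pull_pull]
    congr 1
    funext k
    apply Fin.ext
    simp only [Function.comp_apply, Fin.succAbove, Fin.lt_def, Fin.val_castSucc, Fin.val_cast,
      Fin.val_castAdd]
    split_ifs <;> simp
  have back_low (i : Fin (p + 1)) :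
      (s.face (Fin.cast hpq (Fin.castAdd (q + 1) i))).back (p := p) (q := q) rfl = s.back hp := by
    simp only [Simplex.face, Simplex.back, Simplex.pull_pull]
    congr 1
    funext k
    apply Fin.ext
    have := i.2
    simp only [Function.comp_apply, Fin.succAbove, Fin.lt_def, Fin.val_castSucc, Fin.val_cast,
      Fin.val_castAdd]
    split_ifs <;> simp <;> omega
  have front_high (j : Fin (q + 1)) :
      (s.face (Fin.cast hpq (Fin.natAdd (p + 1) j))).front (p := p) (q := q) rfl =
        s.front hq := by
    simp only [Simplex.face, Simplex.front, Simplex.pull_pull]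
    congr 1
    funext k
    apply Fin.ext
    have := k.2
    simp only [Function.comp_apply, Fin.succAbove, Fin.lt_def, Fin.val_castSucc, Fin.val_cast,
      Fin.val_natAdd]
    split_ifs <;> simp <;> omega
  have back_high (j : Fin (q + 1)) :
      (s.face (Fin.cast hpq (Fin.natAdd (p + 1) j))).back (p := p) (q := q) rfl =
        (s.back hq).face j.succ := by
    simp only [Simplex.face, Simplex.back, Simplex.pull_pull]
    congr 1
    funext k
    apply Fin.ext
    simp only [Function.comp_apply, Fin.succAbove, Fin.lt_def, Fin.val_castSucc, Fin.val_cast,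
      Fin.val_natAdd, Fin.val_succ]
    split_ifs <;> simp <;> omega
  have front_last : (s.front hp).face (Fin.last (p + 1)) = s.front hq := by
    simp only [Simplex.face, Simplex.front, Simplex.pull_pull]
    congr 1
    funext k
    apply Fin.ext
    simp
  have back_zero : (s.back hq).face 0 = s.back hp := by
    simp only [Simplex.face, Simplex.back, Simplex.pull_pull]
    congr 1
    funext k
    apply Fin.ext
    simp
    omega
  change ∑ i : Fin (p + q + 2), (-1) ^ (i : ℕ) * (c ((s.face i).front rfl) *
      d ((s.face i).back rfl)) =
    (∑ i : Fin (p + 2), (-1) ^ (i : ℕ) * c ((s.front hp).face i)) * d (s.back hp) +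
      (-1) ^ p * (c (s.front hq) *
        ∑ j : Fin (q + 2), (-1) ^ (j : ℕ) * d ((s.back hq).face j))
  rw [← Equiv.sum_comp (finCongr hpq), Fin.sum_univ_add, Fin.sum_univ_castSucc (n := p + 1),
    Fin.sum_univ_succ (n := q + 1)]
  simp only [finCongr_apply, front_low, back_low, front_high, back_high, front_last, back_zero,
    Fin.val_cast, Fin.val_castAdd, Fin.val_natAdd, Fin.val_castSucc, Fin.val_last, Fin.val_succ,
    Fin.val_zero, add_mul, mul_add, Finset.sum_mul, Finset.mul_sum]
  have e₁ : ∀ i : Fin (p + 1), (-1 : ℤ) ^ (i : ℕ) * (c ((s.front hp).face i.castSucc) *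
      d (s.back hp)) = (-1) ^ (i : ℕ) * c ((s.front hp).face i.castSucc) * d (s.back hp) :=
    fun i => by ring
  have e₂ : ∀ j : Fin (q + 1), (-1 : ℤ) ^ (p + 1 + (j : ℕ)) * (c (s.front hq) *
      d ((s.back hq).face j.succ)) =
      (-1) ^ p * (c (s.front hq) * ((-1) ^ ((j : ℕ) + 1) * d ((s.back hq).face j.succ))) :=
    fun j => by ring
  simp only [e₁, e₂]
  ring

theorem cup_mem_cocycles {p q n : ℕ} (h : p + q = n) {c : Cochain p X} {d : Cochain q X}
    (hc : c ∈ cocycles p X) (hd : d ∈ cocycles q X) : cupCochain h c d ∈ cocycles n X := by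
  have hc' : coboundary p X c = 0 := hc
  have hd' : coboundary q X d = 0 := hd
  change coboundary n X _ = 0
  rw [coboundary_cup, hc', hd']
  simp

theorem cup_mem_coboundaries_left {p q n : ℕ} (h : p + q = n) {c : Cochain p X} {d : Cochain q X}
    (hc : c ∈ coboundaries p X) (hd : d ∈ cocycles q X) :
    cupCochain h c d ∈ coboundaries n X := by
  have hd' : coboundary q X d = 0 := hd
  cases p with
  | zero =>
    have hc' : c = 0 := hc
    rw [hc', map_zero]
    exact Submodule.zero_mem _
  | succ p =>
    obtain ⟨b, rfl⟩ := hc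
    obtain ⟨m, rfl⟩ : ∃ m, n = m + 1 := ⟨p + q, by omega⟩
    refine ⟨cupCochain (by omega) b d, ?_⟩
    rw [coboundary_cup, hd']
    simp

theorem cup_mem_coboundaries_right {p q n : ℕ} (h : p + q = n) {c : Cochain p X} {d : Cochain q X}
    (hc : c ∈ cocycles p X) (hd : d ∈ coboundaries q X) :
    cupCochain h c d ∈ coboundaries n X := by
  have hc' : coboundary p X c = 0 := hc
  cases q with
  | zero =>
    have hd' : d = 0 := hd
    rw [hd', map_zero]
    exact Submodule.zero_mem _
  | succ q =>
    obtain ⟨b, rfl⟩ := hd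
    obtain ⟨m, rfl⟩ : ∃ m, n = m + 1 := ⟨p + q, by omega⟩
    refine ⟨((-1) ^ p : ℤ) • cupCochain (by omega) c b, ?_⟩
    rw [map_smul, coboundary_cup, hc', map_zero, LinearMap.zero_apply, zero_add, smul_smul,
      ← mul_pow]
    simp

/-- The cup product of cocycles, with values in cohomology. -/
def cupCocycle {p q n : ℕ} (h : p + q = n) :
    cocycles p X →ₗ[ℤ] cocycles q X →ₗ[ℤ] Cohomology n X :=
  LinearMap.mk₂ ℤ
    (fun c d => Submodule.Quotient.mk ⟨cupCochain h c.1 d.1, cup_mem_cocycles h c.2 d.2⟩)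
    (fun c c' d => congrArg Submodule.Quotient.mk (Subtype.ext (by simp)))
    (fun k c d => congrArg Submodule.Quotient.mk (Subtype.ext
      (LinearMap.map_smul₂ (cupCochain h) k c.1 d.1)))
    (fun c d d' => congrArg Submodule.Quotient.mk (Subtype.ext (by simp)))
    (fun k c d => congrArg Submodule.Quotient.mk (Subtype.ext
      ((cupCochain h c.1).map_smul k d.1)))

/-- The cup product `H^p(X) × H^q(X) → H^(p+q)(X)`. -/
def cup (p q : ℕ) : Cohomology p X →ₗ[ℤ] Cohomology q X →ₗ[ℤ] Cohomology (p + q) X :=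
  LinearMap.liftQ₂ _ _ (cupCocycle rfl)
    (fun _ hc => LinearMap.mem_ker.2 <| LinearMap.ext fun d =>
      (Submodule.Quotient.mk_eq_zero _).2 (cup_mem_coboundaries_left rfl hc d.2))
    (fun _ hd => LinearMap.mem_ker.2 <| LinearMap.ext fun c =>
      (Submodule.Quotient.mk_eq_zero _).2 (cup_mem_coboundaries_right rfl c.2 hd))

/-- The pairing `H²(X) × H²(X) → ℤ`, `(x, y) ↦ (x ∪ y) ∩ a`, of a class `a ∈ H₄(X)`. -/
def cupPairing (a : Homology 4 X) : Cohomology 2 X →ₗ[ℤ] Cohomology 2 X →ₗ[ℤ] ℤ :=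
  (cup 2 2).compr₂ ((capEval 4).flip a)

end Products

/-! ### Integral bilinear forms -/

section Forms

variable {V : Type*} [AddCommGroup V]

/-- The quotient of an abelian group by its torsion subgroup. -/
abbrev ModTorsion (V : Type*) [AddCommGroup V] : Type _ := V ⧸ Submodule.torsion ℤ V

theorem torsion_le_ker (F : V →ₗ[ℤ] V →ₗ[ℤ] ℤ) : Submodule.torsion ℤ V ≤ LinearMap.ker F := by
  rintro v ⟨⟨k, hk⟩, hv⟩
  rw [LinearMap.mem_ker]
  refine LinearMap.ext fun w => ?_
  have hkv : k • v = 0 := hv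
  have hz : k • F v w = 0 := by rw [← LinearMap.map_smul₂, hkv, map_zero, LinearMap.zero_apply]
  exact (smul_eq_zero.1 hz).resolve_left (nonZeroDivisors.ne_zero hk)

/-- An integral bilinear form on `V` induces one on `V / torsion`. -/
def formModTorsion (F : V →ₗ[ℤ] V →ₗ[ℤ] ℤ) : ModTorsion V →ₗ[ℤ] ModTorsion V →ₗ[ℤ] ℤ :=
  LinearMap.liftQ₂ _ _ F (torsion_le_ker F) (torsion_le_ker F.flip)

/-- The restriction of an integral bilinear form to a subgroup. -/
def restrictForm (F : V →ₗ[ℤ] V →ₗ[ℤ] ℤ) (W : Submodule ℤ V) : W →ₗ[ℤ] W →ₗ[ℤ] ℤ :=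
  F.compl₁₂ W.subtype W.subtype

/-- The form vanishes identically on the subgroup `W`. -/
def IsIsotropic (F : V →ₗ[ℤ] V →ₗ[ℤ] ℤ) (W : Submodule ℤ V) : Prop :=
  ∀ x ∈ W, ∀ y ∈ W, F x y = 0

/-- `F(v, v)` is even for all `v`. -/
def IsEvenForm (F : V →ₗ[ℤ] V →ₗ[ℤ] ℤ) : Prop :=
  ∀ v, Even (F v v)

/-- The extension of an integral bilinear form to `V ⊗ ℝ`. -/
def realForm (F : V →ₗ[ℤ] V →ₗ[ℤ] ℤ) : LinearMap.BilinForm ℝ (ℝ ⊗[ℤ] V) :=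
  LinearMap.BilinForm.baseChange ℝ F

/-- `b⁺(F)`: the maximal dimension of a real subspace of `V ⊗ ℝ` on which `F` is positive
definite (a supremum in `ℕ∞`, so that no finiteness has to be presupposed). -/
def bPlus (F : V →ₗ[ℤ] V →ₗ[ℤ] ℤ) : ℕ∞ :=
  ⨆ (W : Submodule ℝ (ℝ ⊗[ℤ] V)) (_ : ∀ w ∈ W, w ≠ 0 → 0 < realForm F w w),
    Cardinal.toENat (Module.rank ℝ W)

/-- `b⁻(F)`: the maximal dimension of a real subspace of `V ⊗ ℝ` on which `F` is negative
definite. -/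
def bMinus (F : V →ₗ[ℤ] V →ₗ[ℤ] ℤ) : ℕ∞ :=
  ⨆ (W : Submodule ℝ (ℝ ⊗[ℤ] V)) (_ : ∀ w ∈ W, w ≠ 0 → realForm F w w < 0),
    Cardinal.toENat (Module.rank ℝ W)

end Forms

/-! ### Eilenberg–MacLane spaces and manifolds over them -/

/-- The space `B` is a model of `B_G`: a based, connected CW complex with `π₁(B)` identified
with `G` and `π_i(B) = 0` for `i ≥ 2`. Then `H_*(G) = H_*(B)` and `H^*(G) = H^*(B)`. -/
structure EilenbergMacLane (G : Type*) [Group G] (B : Type*) [TopologicalSpace B] where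
  /-- the base point -/
  base : B
  t2 : T2Space B
  connected : ConnectedSpace B
  cw : Nonempty (Topology.CWComplex (Set.univ : Set B))
  /-- the identification of the fundamental group with `G` -/
  iso : FundamentalGroup B base ≃* G
  aspherical : ∀ i : ℕ, 2 ≤ i → Subsingleton (HomotopyGroup.Pi i B base)

/-- `c ∈ H_n(M)` is a fundamental (orientation) class of the closed `n`-manifold `M`: for every
point `x` its image generates the local homology group `H_n(M, M ∖ {x})`. -/
def IsFundamentalClass (n : ℕ) {M : Type*} [TopologicalSpace M] (c : Homology n M) : Prop :=
  ∀ x : M, Submodule.span ℤ {toRel n ({x}ᶜ : Set M) c} = ⊤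

/-- The pair `(M, φ)`, for the closed 4-manifold `M` with base point `x₀` and orientation
class `c = [M]` and an isomorphism `φ : π₁(M) → G`, lies in `𝓜(G, α)`, where `α ∈ H₄(G)` and
`f : M → B_G` is a based map inducing `φ`: the class `f_*([M])` is `α`. -/
structure MemM {G : Type*} [Group G] {B : Type*} [TopologicalSpace B] (K : EilenbergMacLane G B)
    (α : Homology 4 B) {M : Type*} [TopologicalSpace M] (c : Homology 4 M) {x₀ : M}
    (φ : FundamentalGroup M x₀ ≃* G) (f : C(M, B)) : Prop where
  orientation : IsFundamentalClass 4 c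
  based : f x₀ = K.base
  induces : ∀ γ, K.iso (FundamentalGroup.mapOfEq f based γ) = φ γ
  map_class : Homology.map 4 f c = α

section Intersection

variable {M : Type*} [TopologicalSpace M]

/-- The intersection form `(x, y) ↦ (x ∪ y) ∩ [M]` on `H²(M) / torsion`. -/
def intersectionForm (c : Homology 4 M) :
    ModTorsion (Cohomology 2 M) →ₗ[ℤ] ModTorsion (Cohomology 2 M) →ₗ[ℤ] ℤ :=
  formModTorsion (cupPairing c)

/-- The composite `H²(G) → H²(M) → H²(M) / torsion` of `f^*` and the quotient map. -/
def pullbackModTorsion {B : Type*} [TopologicalSpace B] (f : C(M, B)) :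
    Cohomology 2 B →ₗ[ℤ] ModTorsion (Cohomology 2 M) :=
  (Submodule.torsion ℤ (Cohomology 2 M)).mkQ ∘ₗ Cohomology.map 2 f

/-- `I(M, f)`, the image of `H²(G) → H²(M) → H²(M) / torsion`. -/
def imageI {B : Type*} [TopologicalSpace B] (f : C(M, B)) :
    Submodule ℤ (ModTorsion (Cohomology 2 M)) :=
  LinearMap.range (pullbackModTorsion f)

end Intersection

end GroupGeography

end

noncomputable section

namespace GroupGeography

/-!
The cup product pairing is natural, so everything reduces to the injectivity of `f^*` on `H²`, which
holds whenever `f` is an isomorphism on `π₁` and `π₂(B) = 0`. Let the pullback of a cocycle `c` be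
the coboundary of `b`. Choosing paths from all points of `B` to the base point and filling horns,
push every edge `e` of `B` onto the image of a loop `γ` of `M`; the cochain which adds to `b(γ)` the
value of `c` on the square swept out by `e` has coboundary `c`. Indeed, pushing the boundary of a
triangle `τ` like this pushes `τ` itself onto a triangle `E` bounded by images of loops. As `f` is
injective on `π₁`, these loops bound a triangle `D` in `M`, and `c` agrees on `E` and `f ∘ D`, since
`π₂(B) = 0` forces a cocycle to take equal values on triangles with the same boundary.
-/

open Set
open scoped unitInterval

section Simplices

variable {X : Type*} [TopologicalSpace X] {n : ℕ}

theorem stdSimplex_map_succAbove_apply (i : Fin (n + 1)) (x : stdSimplex ℝ (Fin n))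
    (k : Fin n) : stdSimplex.map i.succAbove x (i.succAbove k) = x k := by
  rw [stdSimplex.map_coe, FunOnFinite.linearMap_apply_apply]
  simp [Fin.succAbove_right_injective.eq_iff, Finset.sum_filter]

theorem stdSimplex_map_succAbove_self (i : Fin (n + 1)) (x : stdSimplex ℝ (Fin n)) :
    stdSimplex.map i.succAbove x i = 0 := by
  rw [stdSimplex.map_coe, FunOnFinite.linearMap_apply_apply]
  exact Finset.sum_eq_zero fun k hk => absurd (Finset.mem_filter.1 hk).2 (i.succAbove_ne k)

theorem stdSimplex_map_succAbove_injective (i : Fin (n + 1)) :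
    Function.Injective (stdSimplex.map (S := ℝ) i.succAbove) := by
  intro x y h
  refine stdSimplex.ext (funext fun k => ?_)
  rw [← stdSimplex_map_succAbove_apply i x, h, stdSimplex_map_succAbove_apply]

theorem exists_stdSimplex_map_succAbove_eq {i : Fin (n + 1)}
    {x : stdSimplex ℝ (Fin (n + 1))} (hx : x i = 0) : ∃ y, stdSimplex.map i.succAbove y = x := by
  refine ⟨⟨fun k => x (i.succAbove k), fun k => stdSimplex.zero_le x _, ?_⟩,
    stdSimplex.ext (funext fun j => ?_)⟩
  · rw [← stdSimplex.sum_eq_one x, Fin.sum_univ_succAbove _ i, hx, zero_add]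
  · rcases Fin.eq_self_or_eq_succAbove i j with rfl | ⟨k, rfl⟩
    · rw [stdSimplex_map_succAbove_self, hx]
    · exact stdSimplex_map_succAbove_apply i _ k

theorem stdSimplex_map_succAbove_map_succAbove {i j : Fin (n + 2)} (h : i ≤ j)
    (x : stdSimplex ℝ (Fin (n + 1))) :
    stdSimplex.map i.castSucc.succAbove (stdSimplex.map j.succAbove x) =
      stdSimplex.map j.succ.succAbove (stdSimplex.map i.succAbove x) := by
  rw [stdSimplex.map_comp_apply, stdSimplex.map_comp_apply]
  congr 1
  exact congrArg (fun v : SimplexCategory.mk n ⟶ SimplexCategory.mk (n + 2) =>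
    (v.toOrderHom : Fin (n + 1) → Fin (n + 3))) (SimplexCategory.δ_comp_δ h).symm

theorem mem_stdSimplex_insertNth_sub (i : Fin (n + 2))
    (x : stdSimplex ℝ (Fin (n + 2))) {m : ℝ} (hm : 0 ≤ m) (hx : ∀ k, m ≤ x (i.succAbove k)) :
    i.insertNth (x i + (n + 1) * m) (fun k => x (i.succAbove k) - m) ∈
      stdSimplex ℝ (Fin (n + 2)) := by
  constructor
  · rw [Fin.forall_iff_succAbove i]
    simp only [Fin.insertNth_apply_same, Fin.insertNth_apply_succAbove, sub_nonneg]
    exact ⟨add_nonneg (stdSimplex.zero_le x i) (by positivity), hx⟩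
  · have hsum := stdSimplex.sum_eq_one x
    rw [Fin.sum_univ_succAbove _ i] at hsum ⊢
    simp only [Fin.insertNth_apply_same, Fin.insertNth_apply_succAbove, Finset.sum_sub_distrib,
      Finset.sum_const, Finset.card_univ, Fintype.card_fin, nsmul_eq_mul]
    push_cast
    linarith

/-- The smallest barycentric coordinate of a point at a vertex other than `i`. -/
def minCoord (i : Fin (n + 2)) (x : stdSimplex ℝ (Fin (n + 2))) : ℝ :=
  Finset.univ.inf' Finset.univ_nonempty fun k : Fin (n + 1) => x (i.succAbove k)

theorem minCoord_le (i : Fin (n + 2)) (x : stdSimplex ℝ (Fin (n + 2))) (k : Fin (n + 1)) :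
    minCoord i x ≤ x (i.succAbove k) :=
  Finset.inf'_le _ (Finset.mem_univ k)

theorem minCoord_nonneg (i : Fin (n + 2)) (x : stdSimplex ℝ (Fin (n + 2))) :
    0 ≤ minCoord i x :=
  Finset.le_inf' _ _ fun _ _ => stdSimplex.zero_le x _

theorem exists_eq_minCoord (i : Fin (n + 2)) (x : stdSimplex ℝ (Fin (n + 2))) :
    ∃ k, x (i.succAbove k) = minCoord i x :=
  let ⟨k, _, hk⟩ := Finset.exists_mem_eq_inf' Finset.univ_nonempty fun k => x (i.succAbove k)
  ⟨k, hk.symm⟩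

theorem continuous_stdSimplex_apply {ι : Type*} [Fintype ι] (j : ι) :
    Continuous fun x : stdSimplex ℝ ι => x j :=
  (continuous_apply j).comp continuous_subtype_val

theorem continuous_minCoord (i : Fin (n + 2)) : Continuous (minCoord i) :=
  Continuous.finset_inf'_apply _ fun _ _ => continuous_stdSimplex_apply _

/-- The `i`-th horn, the union of all faces of the standard simplex but the `i`-th one. -/
def horn (i : Fin (n + 2)) : Set (stdSimplex ℝ (Fin (n + 2))) :=
  {x | ∃ j ≠ i, x j = 0}

/-- The projection of the simplex onto its `i`-th horn, away from the barycentre of the `i`-th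
face. -/
def hornProjection (i : Fin (n + 2)) (x : stdSimplex ℝ (Fin (n + 2))) :
    stdSimplex ℝ (Fin (n + 2)) :=
  ⟨i.insertNth (x i + (n + 1) * minCoord i x) fun k => x (i.succAbove k) - minCoord i x,
    mem_stdSimplex_insertNth_sub i x (minCoord_nonneg i x) (minCoord_le i x)⟩

theorem hornProjection_apply_self (i : Fin (n + 2)) (x : stdSimplex ℝ (Fin (n + 2))) :
    hornProjection i x i = x i + (n + 1) * minCoord i x :=
  Fin.insertNth_apply_same (α := fun _ => ℝ) i (x i + (n + 1) * minCoord i x)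
    fun k => x (i.succAbove k) - minCoord i x

theorem hornProjection_apply_succAbove (i : Fin (n + 2))
    (x : stdSimplex ℝ (Fin (n + 2))) (k : Fin (n + 1)) :
    hornProjection i x (i.succAbove k) = x (i.succAbove k) - minCoord i x :=
  Fin.insertNth_apply_succAbove (α := fun _ => ℝ) i (x i + (n + 1) * minCoord i x)
    (fun k => x (i.succAbove k) - minCoord i x) k

theorem hornProjection_mem (i : Fin (n + 2)) (x : stdSimplex ℝ (Fin (n + 2))) :
    hornProjection i x ∈ horn i := by
  obtain ⟨k, hk⟩ := exists_eq_minCoord i x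
  exact ⟨_, i.succAbove_ne k, by rw [hornProjection_apply_succAbove, hk, sub_self]⟩

theorem hornProjection_of_mem {i : Fin (n + 2)} {x : stdSimplex ℝ (Fin (n + 2))}
    (hx : x ∈ horn i) : hornProjection i x = x := by
  obtain ⟨j, hj, hx⟩ := hx
  obtain ⟨k, rfl⟩ := Fin.exists_succAbove_eq hj
  have hm : minCoord i x = 0 := le_antisymm (hx ▸ minCoord_le i x k) (minCoord_nonneg i x)
  refine stdSimplex.ext (funext ((Fin.forall_iff_succAbove i).2 ⟨?_, fun l => ?_⟩))
  · rw [hornProjection_apply_self, hm, mul_zero, add_zero]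
  · rw [hornProjection_apply_succAbove, hm, sub_zero]

theorem continuous_hornProjection (i : Fin (n + 2)) : Continuous (hornProjection i) := by
  refine Continuous.subtype_mk (Continuous.finInsertNth i ?_ (continuous_pi fun k => ?_)) _
  · exact (continuous_stdSimplex_apply i).add ((continuous_minCoord i).const_mul _)
  · exact (continuous_stdSimplex_apply _).sub (continuous_minCoord i)

/-- The retraction of the simplex onto its `i`-th horn. -/
def hornRetraction (i : Fin (n + 2)) : C(stdSimplex ℝ (Fin (n + 2)), horn i) :=
  ⟨fun x => ⟨hornProjection i x, hornProjection_mem i x⟩,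
    (continuous_hornProjection i).subtype_mk _⟩

theorem hornRetraction_coe {i : Fin (n + 2)} (x : horn i) : hornRetraction i x = x :=
  Subtype.ext (hornProjection_of_mem x.2)

/-- The faces of the `i`-th horn, glued together to the horn itself. -/
def sigmaToHorn (i : Fin (n + 3)) :
    C(Σ _ : {j // j ≠ i}, stdSimplex ℝ (Fin (n + 2)), horn i) where
  toFun p := ⟨stdSimplex.map p.1.1.succAbove p.2, p.1, p.1.2, stdSimplex_map_succAbove_self _ _⟩
  continuous_toFun :=
    (continuous_sigma fun j => stdSimplex.continuous_map j.1.succAbove).subtype_mk _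

theorem isQuotientMap_sigmaToHorn (i : Fin (n + 3)) :
    Topology.IsQuotientMap (sigmaToHorn i) := by
  refine Topology.IsQuotientMap.of_surjective_continuous ?_ (sigmaToHorn i).continuous
  rintro ⟨x, j, hj, hx⟩
  obtain ⟨y, rfl⟩ := exists_stdSimplex_map_succAbove_eq hx
  exact ⟨⟨⟨j, hj⟩, y⟩, rfl⟩

namespace Simplex

theorem face_apply (i : Fin (n + 2)) (s : Simplex (n + 1) X)
    (x : stdSimplex ℝ (Fin (n + 1))) : s.face i x = s (stdSimplex.map i.succAbove x) :=
  rfl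

theorem face_face (s : Simplex (n + 2) X) {i j : Fin (n + 2)} (h : i ≤ j) :
    (s.face i.castSucc).face j = (s.face j.succ).face i :=
  ContinuousMap.ext fun x => congrArg s (stdSimplex_map_succAbove_map_succAbove h x)

theorem face_vertex (i : Fin (n + 2)) (s : Simplex (n + 1) X) (k : Fin (n + 1)) :
    s.face i (stdSimplex.vertex k) = s (stdSimplex.vertex (i.succAbove k)) := by
  rw [face_apply, stdSimplex.map_vertex]

theorem eq_of_map_succAbove_eq {s : Fin (n + 3) → Simplex (n + 1) X}
    {j k : Fin (n + 2)} (h : j ≤ k) (hs : (s j.castSucc).face k = (s k.succ).face j)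
    {x y : stdSimplex ℝ (Fin (n + 2))}
    (hxy : stdSimplex.map j.castSucc.succAbove x = stdSimplex.map k.succ.succAbove y) :
    s j.castSucc x = s k.succ y := by
  have hx : x k = 0 := by
    rw [← stdSimplex_map_succAbove_apply j.castSucc, hxy,
      Fin.succAbove_castSucc_of_le _ _ h, stdSimplex_map_succAbove_self]
  obtain ⟨z, rfl⟩ := exists_stdSimplex_map_succAbove_eq hx
  rw [stdSimplex_map_succAbove_map_succAbove h] at hxy
  rw [← stdSimplex_map_succAbove_injective _ hxy]
  exact DFunLike.congr_fun hs z

theorem exists_forall_face_eq (i : Fin (n + 3)) (s : Fin (n + 3) → Simplex (n + 1) X)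
    (hs : ∀ j k : Fin (n + 2), j ≤ k → j.castSucc ≠ i → k.succ ≠ i →
      (s j.castSucc).face k = (s k.succ).face j) :
    ∃ t : Simplex (n + 2) X, ∀ j ≠ i, t.face j = s j := by
  have compat {j k : Fin (n + 3)} (hj : j ≠ i) (hk : k ≠ i) {x y : stdSimplex ℝ (Fin (n + 2))}
      (h : stdSimplex.map j.succAbove x = stdSimplex.map k.succAbove y) : s j x = s k y := by
    wlog hjk : j ≤ k generalizing j k x y
    · exact (this hk hj h.symm (le_of_not_ge hjk)).symm
    obtain rfl | hlt := hjk.eq_or_lt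
    · rw [stdSimplex_map_succAbove_injective j h]
    · obtain ⟨k, rfl⟩ := Fin.exists_succ_eq.2 (Fin.ne_zero_of_lt hlt)
      obtain ⟨j, rfl⟩ := Fin.exists_castSucc_eq.2 (Fin.ne_last_of_lt hlt)
      have hle : j ≤ k := Fin.castSucc_lt_succ_iff.1 hlt
      exact eq_of_map_succAbove_eq hle (hs j k hle hj hk) h
  let g : C(Σ _ : {j // j ≠ i}, stdSimplex ℝ (Fin (n + 2)), X) :=
    ⟨fun p => s p.1 p.2, continuous_sigma fun j => (s j).continuous⟩
  have hg : Function.FactorsThrough g (sigmaToHorn i) := fun p q h =>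
    compat p.1.2 q.1.2 (congrArg Subtype.val h)
  refine ⟨((isQuotientMap_sigmaToHorn i).lift g hg).comp (hornRetraction i), fun j hj => ?_⟩
  ext x
  let p : Σ _ : {j // j ≠ i}, stdSimplex ℝ (Fin (n + 2)) := ⟨⟨j, hj⟩, x⟩
  calc (isQuotientMap_sigmaToHorn i).lift g hg (hornRetraction i (sigmaToHorn i p))
      = (isQuotientMap_sigmaToHorn i).lift g hg (sigmaToHorn i p) := by
        rw [hornRetraction_coe]
    _ = g p := DFunLike.congr_fun ((isQuotientMap_sigmaToHorn i).lift_comp g hg) p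

end Simplex

theorem stdSimplex_map_const {ι κ : Type*} [Fintype ι] [Fintype κ] [DecidableEq κ] (k : κ)
    (x : stdSimplex ℝ ι) : stdSimplex.map (fun _ => k) x = stdSimplex.vertex k := by
  change stdSimplex.map ((fun _ : Fin 1 => k) ∘ fun _ => 0) x = _
  rw [← stdSimplex.map_comp_apply, Subsingleton.elim (stdSimplex.map _ x)
    (stdSimplex.vertex (0 : Fin 1)), stdSimplex.map_vertex]

namespace Simplex

theorem pull_id (s : Simplex n X) : s.pull id = s :=
  ContinuousMap.ext fun x => congrArg s (stdSimplex.map_id_apply x)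

theorem pull_const {m : ℕ} (s : Simplex n X) (k : Fin (n + 1)) :
    s.pull (fun _ : Fin (m + 1) => k) = ContinuousMap.const _ (s (stdSimplex.vertex k)) :=
  ContinuousMap.ext fun x => congrArg s (stdSimplex_map_const k x)

theorem face_pull {m : ℕ} (s : Simplex n X) {v : Fin (m + 2) → Fin (n + 1)} {i : Fin (m + 2)}
    {w : Fin (m + 1) → Fin (n + 1)} (h : v ∘ i.succAbove = w) : (s.pull v).face i = s.pull w :=
  h ▸ pull_pull _ _ _

/-- The degenerate triangle on the vertices `0, 0, 1` of an edge. -/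
def degenerateLeft (e : Simplex 1 X) : Simplex 2 X :=
  e.pull ![0, 0, 1]

/-- The degenerate triangle on the vertices `0, 1, 1` of an edge. -/
def degenerateRight (e : Simplex 1 X) : Simplex 2 X :=
  e.pull ![0, 1, 1]

theorem degenerateLeft_face_zero (e : Simplex 1 X) : e.degenerateLeft.face 0 = e :=
  (e.face_pull (by decide)).trans e.pull_id

theorem degenerateLeft_face_one (e : Simplex 1 X) : e.degenerateLeft.face 1 = e :=
  (e.face_pull (by decide)).trans e.pull_id

theorem degenerateLeft_face_two (e : Simplex 1 X) :
    e.degenerateLeft.face 2 = ContinuousMap.const _ (e (stdSimplex.vertex 0)) :=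
  (e.face_pull (by decide)).trans (e.pull_const 0)

theorem degenerateRight_face_zero (e : Simplex 1 X) :
    e.degenerateRight.face 0 = ContinuousMap.const _ (e (stdSimplex.vertex 1)) :=
  (e.face_pull (by decide)).trans (e.pull_const 1)

theorem degenerateRight_face_one (e : Simplex 1 X) : e.degenerateRight.face 1 = e :=
  (e.face_pull (by decide)).trans e.pull_id

theorem degenerateRight_face_two (e : Simplex 1 X) : e.degenerateRight.face 2 = e :=
  (e.face_pull (by decide)).trans e.pull_id

/-- Four triangles are the faces, in this order, of a singular tetrahedron. -/
def IsTetrahedron (s₀ s₁ s₂ s₃ : Simplex 2 X) : Prop :=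
  ∃ t : Simplex 3 X, t.face 0 = s₀ ∧ t.face 1 = s₁ ∧ t.face 2 = s₂ ∧ t.face 3 = s₃

section IsTetrahedron

variable {s₀ s₁ s₂ s₃ : Simplex 2 X}

theorem isTetrahedron_faces (t : Simplex 3 X) :
    IsTetrahedron (t.face 0) (t.face 1) (t.face 2) (t.face 3) :=
  ⟨t, rfl, rfl, rfl, rfl⟩

theorem IsTetrahedron.edge₀₁ : IsTetrahedron s₀ s₁ s₂ s₃ → s₀.face 0 = s₁.face 0 := by
  rintro ⟨t, rfl, rfl, rfl, rfl⟩
  exact t.face_face (i := 0) (j := 0) le_rfl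

theorem IsTetrahedron.edge₀₂ : IsTetrahedron s₀ s₁ s₂ s₃ → s₀.face 1 = s₂.face 0 := by
  rintro ⟨t, rfl, rfl, rfl, rfl⟩
  exact t.face_face (i := 0) (j := 1) (by decide)

theorem IsTetrahedron.edge₀₃ : IsTetrahedron s₀ s₁ s₂ s₃ → s₀.face 2 = s₃.face 0 := by
  rintro ⟨t, rfl, rfl, rfl, rfl⟩
  exact t.face_face (i := 0) (j := 2) (by decide)

theorem IsTetrahedron.edge₁₂ : IsTetrahedron s₀ s₁ s₂ s₃ → s₁.face 1 = s₂.face 1 := by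
  rintro ⟨t, rfl, rfl, rfl, rfl⟩
  exact t.face_face (i := 1) (j := 1) le_rfl

theorem IsTetrahedron.edge₁₃ : IsTetrahedron s₀ s₁ s₂ s₃ → s₁.face 2 = s₃.face 1 := by
  rintro ⟨t, rfl, rfl, rfl, rfl⟩
  exact t.face_face (i := 1) (j := 2) (by decide)

theorem IsTetrahedron.edge₂₃ : IsTetrahedron s₀ s₁ s₂ s₃ → s₂.face 2 = s₃.face 2 := by
  rintro ⟨t, rfl, rfl, rfl, rfl⟩
  exact t.face_face (i := 2) (j := 2) le_rfl

theorem IsTetrahedron.cocycle_sum (h : IsTetrahedron s₀ s₁ s₂ s₃) {c : Cochain 2 X}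
    (hc : c ∈ cocycles 2 X) : c s₀ - c s₁ + c s₂ - c s₃ = 0 := by
  obtain ⟨t, rfl, rfl, rfl, rfl⟩ := h
  have hsum : ∑ i : Fin 4, (-1) ^ (i : ℕ) * c (t.face i) = 0 := congrFun hc t
  simpa [Fin.sum_univ_four, pow_succ, sub_eq_add_neg] using hsum

theorem exists_isTetrahedron₀ (h₁₂ : s₁.face 1 = s₂.face 1) (h₁₃ : s₁.face 2 = s₃.face 1)
    (h₂₃ : s₂.face 2 = s₃.face 2) : ∃ s₀, IsTetrahedron s₀ s₁ s₂ s₃ := by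
  obtain ⟨t, ht⟩ := exists_forall_face_eq 0 ![s₁, s₁, s₂, s₃] fun j k _ _ _ => by
    fin_cases j <;> fin_cases k <;> simp_all
  exact ⟨t.face 0, t, rfl, ht 1 (by decide), ht 2 (by decide), ht 3 (by decide)⟩

theorem exists_isTetrahedron₁ (h₀₂ : s₀.face 1 = s₂.face 0) (h₀₃ : s₀.face 2 = s₃.face 0)
    (h₂₃ : s₂.face 2 = s₃.face 2) : ∃ s₁, IsTetrahedron s₀ s₁ s₂ s₃ := by
  obtain ⟨t, ht⟩ := exists_forall_face_eq 1 ![s₀, s₀, s₂, s₃] fun j k _ _ _ => by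
    fin_cases j <;> fin_cases k <;> simp_all
  exact ⟨t.face 1, t, ht 0 (by decide), rfl, ht 2 (by decide), ht 3 (by decide)⟩

theorem exists_isTetrahedron₂ (h₀₁ : s₀.face 0 = s₁.face 0) (h₀₃ : s₀.face 2 = s₃.face 0)
    (h₁₃ : s₁.face 2 = s₃.face 1) : ∃ s₂, IsTetrahedron s₀ s₁ s₂ s₃ := by
  obtain ⟨t, ht⟩ := exists_forall_face_eq 2 ![s₀, s₁, s₀, s₃] fun j k _ _ _ => by
    fin_cases j <;> fin_cases k <;> simp_all
  exact ⟨t.face 2, t, ht 0 (by decide), ht 1 (by decide), rfl, ht 3 (by decide)⟩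

end IsTetrahedron

theorem exists_triangle {p q : Simplex 1 X}
    (h : p (stdSimplex.vertex 1) = q (stdSimplex.vertex 0)) :
    ∃ τ : Simplex 2 X, τ.face 2 = p ∧ τ.face 0 = q := by
  obtain ⟨t, ht⟩ := exists_forall_face_eq 1 ![q, q, p] fun j k hjk hj hk => by
    have h01 : j = 0 ∧ k = 1 := by
      revert hjk hj hk
      fin_cases j <;> fin_cases k <;> decide
    obtain ⟨rfl, rfl⟩ := h01
    ext x
    rw [Subsingleton.elim x (stdSimplex.vertex 0), face_vertex, face_vertex]
    exact h.symm
  exact ⟨t, ht 2 (by decide), ht 0 (by decide)⟩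

theorem cocycle_degenerateRight {c : Cochain 2 X} (hc : c ∈ cocycles 2 X) (e : Simplex 1 X) :
    c e.degenerateRight = c (ContinuousMap.const _ (e (stdSimplex.vertex 1))) := by
  have h := (isTetrahedron_faces (e.pull ![0, 1, 1, 1])).cocycle_sum hc
  rw [e.face_pull (w := fun _ => 1) (by decide), e.face_pull (w := ![0, 1, 1]) (by decide),
    e.face_pull (w := ![0, 1, 1]) (by decide), e.face_pull (w := ![0, 1, 1]) (by decide),
    pull_const] at h
  rw [degenerateRight]
  linarith

end Simplex

/-- The last `n + 1 - r` barycentric coordinates of a point of the `n`-simplex added up: the affine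
function with value `0` at the vertices before the `r`-th and `1` at the others. -/
def tailSum (r : ℕ) (x : stdSimplex ℝ (Fin (n + 1))) : I :=
  stdSimplexHomeomorphUnitInterval (stdSimplex.map (fun k => if k.val < r then 0 else 1) x)

section tailSum

variable {r : ℕ}

theorem coe_tailSum (x : stdSimplex ℝ (Fin (n + 1))) :
    (tailSum r x : ℝ) = ∑ k with r ≤ k.val, x k :=
  (FunOnFinite.linearMap_apply_apply ℝ ℝ _ (x : Fin (n + 1) → ℝ) 1).trans
    (by simp only [ite_eq_right_iff, Fin.zero_eq_one_iff, OfNat.ofNat_ne_one, imp_false, not_lt])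

theorem continuous_tailSum : Continuous (tailSum r : stdSimplex ℝ (Fin (n + 1)) → I) :=
  stdSimplexHomeomorphUnitInterval.continuous.comp (stdSimplex.continuous_map _)

theorem antitone_tailSum (x : stdSimplex ℝ (Fin (n + 1))) :
    Antitone fun r => tailSum r x := fun r r' h => Subtype.coe_le_coe.1 <| by
  rw [coe_tailSum, coe_tailSum]
  exact Finset.sum_le_sum_of_subset_of_nonneg
    (Finset.monotone_filter_right _ fun k _ hk => h.trans hk) fun k _ _ => stdSimplex.zero_le x k

theorem tailSum_zero (x : stdSimplex ℝ (Fin (n + 1))) : tailSum 0 x = 1 :=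
  Subtype.ext ((coe_tailSum x).trans (by simp))

theorem tailSum_of_lt (h : n < r) (x : stdSimplex ℝ (Fin (n + 1))) : tailSum r x = 0 :=
  Subtype.ext ((coe_tailSum x).trans (Finset.sum_eq_zero fun k hk =>
    absurd (Finset.mem_filter.1 hk).2 (by omega)))

theorem tailSum_one (x : stdSimplex ℝ (Fin 2)) :
    tailSum 1 x = stdSimplexHomeomorphUnitInterval x := by
  have hid : (fun k : Fin 2 => if k.val < 1 then (0 : Fin 2) else 1) = id := by decide
  rw [tailSum, hid, stdSimplex.map_id_apply]

theorem tailSum_map_succAbove (i : Fin (n + 2)) (x : stdSimplex ℝ (Fin (n + 1))) :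
    tailSum r (stdSimplex.map i.succAbove x) = tailSum (if i < r then r - 1 else r) x := by
  rw [tailSum, stdSimplex.map_comp_apply, tailSum]
  congr 2
  ext k
  simp only [Function.comp_apply, Fin.succAbove, Fin.lt_def, Fin.val_castSucc]
  split_ifs <;> simp_all <;> omega

end tailSum

namespace Simplex

/-- The singular simplex obtained from a map on a cube by restricting it to the affine simplex
whose `k`-th vertex is the vertex of the cube with `l`-th coordinate `0` if `k < r l` and `1`
otherwise. -/
def ofCube {N : Type*} (K : C(N → I, X)) (r : N → ℕ) : Simplex n X :=
  K.comp ⟨fun x l => tailSum (r l) x, continuous_pi fun _ => continuous_tailSum⟩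

theorem ofCube_apply {N : Type*} (K : C(N → I, X)) (r : N → ℕ)
    (x : stdSimplex ℝ (Fin (n + 1))) : ofCube K r x = K fun l => tailSum (r l) x :=
  rfl

theorem face_ofCube {N : Type*} {K : C(N → I, X)} {r r' : N → ℕ} {i : Fin (n + 2)}
    (h : ∀ l, (if i < r l then r l - 1 else r l) = r' l) :
    (ofCube K r).face i = ofCube K r' := by
  ext x
  rw [face_apply, ofCube_apply, ofCube_apply]
  simp only [tailSum_map_succAbove, h]

end Simplex

/-- A path, regarded as a singular edge. -/
def pathSimplex {a b : X} (p : Path a b) : Simplex 1 X :=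
  p.toContinuousMap.comp ⟨_, stdSimplexHomeomorphUnitInterval.continuous⟩

theorem pathSimplex_apply {a b : X} (p : Path a b) (x : stdSimplex ℝ (Fin 2)) :
    pathSimplex p x = p (stdSimplexHomeomorphUnitInterval x) :=
  rfl

theorem pathSimplex_vertex_zero {a b : X} (p : Path a b) :
    pathSimplex p (stdSimplex.vertex 0) = a :=
  p.source

theorem pathSimplex_vertex_one {a b : X} (p : Path a b) :
    pathSimplex p (stdSimplex.vertex 1) = b :=
  p.target

theorem pathSimplex_injective {a b : X} :
    Function.Injective (pathSimplex : Path a b → Simplex 1 X) := fun p q h => by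
  ext t
  have ht := DFunLike.congr_fun h (stdSimplexHomeomorphUnitInterval.symm t)
  simpa only [pathSimplex_apply, Homeomorph.apply_symm_apply] using ht

theorem exists_pathSimplex_eq {e : Simplex 1 X} {a b : X} (ha : e (stdSimplex.vertex 0) = a)
    (hb : e (stdSimplex.vertex 1) = b) : ∃ p : Path a b, pathSimplex p = e := by
  refine ⟨⟨e.comp ⟨_, stdSimplexHomeomorphUnitInterval.symm.continuous⟩, ?_, ?_⟩, ?_⟩
  · rw [← ha]
    exact congrArg e (stdSimplexHomeomorphUnitInterval.symm_apply_eq.2 rfl)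
  · rw [← hb]
    exact congrArg e (stdSimplexHomeomorphUnitInterval.symm_apply_eq.2 rfl)
  · ext x
    exact congrArg e (stdSimplexHomeomorphUnitInterval.symm_apply_apply x)

open Simplex

theorem exists_simplex_of_homotopic {a b : X} {p q : Path a b} (h : p.Homotopic q) :
    ∃ τ : Simplex 2 X, τ.face 2 = pathSimplex p ∧ τ.face 1 = pathSimplex q ∧
      τ.face 0 = ContinuousMap.const _ b := by
  obtain ⟨H⟩ := h
  let K : C(Fin 2 → I, X) :=
    H.toContinuousMap.comp ((ContinuousMap.eval 0).prodMk (ContinuousMap.eval 1))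
  have hK (r : Fin 2 → ℕ) (x : stdSimplex ℝ (Fin 2)) :
      ofCube K r x = H (tailSum (r 0) x, tailSum (r 1) x) := rfl
  let lower : Simplex 2 X := ofCube K ![2, 1]
  let upper : Simplex 2 X := ofCube K ![1, 2]
  have lower_two : lower.face 2 = pathSimplex p := by
    rw [face_ofCube (r' := ![2, 1]) (by decide)]
    ext x
    simp [hK, tailSum_of_lt, tailSum_one, pathSimplex_apply]
  have lower_zero : lower.face 0 = ContinuousMap.const _ b := by
    rw [face_ofCube (r' := ![1, 0]) (by decide)]
    ext x
    simp [hK, tailSum_zero]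
  have upper_two : upper.face 2 = ContinuousMap.const _ a := by
    rw [face_ofCube (r' := ![1, 2]) (by decide)]
    ext x
    simp [hK, tailSum_of_lt]
  have upper_zero : upper.face 0 = pathSimplex q := by
    rw [face_ofCube (r' := ![0, 1]) (by decide)]
    ext x
    simp [hK, tailSum_zero, tailSum_one, pathSimplex_apply]
  have diagonal : lower.face 1 = upper.face 1 :=
    (face_ofCube (r' := ![1, 1]) (by decide)).trans (face_ofCube (by decide)).symm
  obtain ⟨τ, hτ⟩ := exists_isTetrahedron₀ (s₁ := lower) (s₂ := upper)
    (s₃ := (pathSimplex p).degenerateLeft) diagonal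
    (by rw [lower_two, degenerateLeft_face_one])
    (by rw [upper_two, degenerateLeft_face_two, pathSimplex_vertex_zero])
  exact ⟨τ, hτ.edge₀₃.trans (degenerateLeft_face_zero _), hτ.edge₀₂.trans upper_zero,
    hτ.edge₀₁.trans lower_zero⟩

theorem homotopic_trans_of_faces {a b d : X} {p : Path a b} {q : Path b d} {r : Path a d}
    {τ : Simplex 2 X} (hp : τ.face 2 = pathSimplex p) (hq : τ.face 0 = pathSimplex q)
    (hr : τ.face 1 = pathSimplex r) : (p.trans q).Homotopic r := by
  have : ContractibleSpace (stdSimplex ℝ (Fin 3)) :=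
    (convex_stdSimplex ℝ (Fin 3)).contractibleSpace ⟨_, (stdSimplex.vertex 0).2⟩
  let ι : Simplex 2 (stdSimplex ℝ (Fin 3)) := ContinuousMap.id _
  obtain ⟨e₀₁, h₀₁⟩ := exists_pathSimplex_eq (a := stdSimplex.vertex 0)
    (b := stdSimplex.vertex 1) (ι.face_vertex 2 0) (ι.face_vertex 2 1)
  obtain ⟨e₁₂, h₁₂⟩ := exists_pathSimplex_eq (a := stdSimplex.vertex 1)
    (b := stdSimplex.vertex 2) (ι.face_vertex 0 0) (ι.face_vertex 0 1)
  obtain ⟨e₀₂, h₀₂⟩ := exists_pathSimplex_eq (a := stdSimplex.vertex 0)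
    (b := stdSimplex.vertex 2) (ι.face_vertex 1 0) (ι.face_vertex 1 1)
  obtain rfl : τ (stdSimplex.vertex 0) = a := by
    rw [← pathSimplex_vertex_zero p, ← hp, τ.face_vertex]; rfl
  obtain rfl : τ (stdSimplex.vertex 1) = b := by
    rw [← pathSimplex_vertex_zero q, ← hq, τ.face_vertex]; rfl
  obtain rfl : τ (stdSimplex.vertex 2) = d := by
    rw [← pathSimplex_vertex_one q, ← hq, τ.face_vertex]; rfl
  obtain rfl : e₀₁.map τ.continuous = p :=
    pathSimplex_injective ((congrArg τ.comp h₀₁).trans hp)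
  obtain rfl : e₁₂.map τ.continuous = q :=
    pathSimplex_injective ((congrArg τ.comp h₁₂).trans hq)
  obtain rfl : e₀₂.map τ.continuous = r :=
    pathSimplex_injective ((congrArg τ.comp h₀₂).trans hr)
  rw [← Path.map_trans]
  exact (SimplyConnectedSpace.paths_homotopic (e₀₁.trans e₁₂) e₀₂).map τ

theorem homotopic_trans_iff {a b d : X} {p : Path a b} {q : Path b d} {r : Path a d} :
    (p.trans q).Homotopic r ↔ ∃ τ : Simplex 2 X, τ.face 2 = pathSimplex p ∧
      τ.face 0 = pathSimplex q ∧ τ.face 1 = pathSimplex r := by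
  refine ⟨fun h => ?_, fun ⟨τ, hp, hq, hr⟩ => homotopic_trans_of_faces hp hq hr⟩
  obtain ⟨τ, hp, hq⟩ := exists_triangle (p := pathSimplex p) (q := pathSimplex q)
    ((pathSimplex_vertex_one p).trans (pathSimplex_vertex_zero q).symm)
  obtain ⟨r', hr'⟩ := exists_pathSimplex_eq (e := τ.face 1) (a := a) (b := d)
    (by rw [τ.face_vertex, ← pathSimplex_vertex_zero p, ← hp, τ.face_vertex]; rfl)
    (by rw [τ.face_vertex, ← pathSimplex_vertex_one q, ← hq, τ.face_vertex]; rfl)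
  have hr'r : r'.Homotopic r := (homotopic_trans_of_faces hp hq hr'.symm).symm.trans h
  obtain ⟨s₁, hs₁r', hs₁r, hs₁d⟩ := exists_simplex_of_homotopic hr'r
  obtain ⟨s₂, hs₂⟩ := exists_isTetrahedron₂ (s₀ := (pathSimplex q).degenerateRight) (s₁ := s₁)
    (s₃ := τ) (by rw [degenerateRight_face_zero, hs₁d, pathSimplex_vertex_one])
    (by rw [degenerateRight_face_two, hq]) (hs₁r'.trans hr')
  exact ⟨s₂, hs₂.edge₂₃.trans hp, hs₂.edge₀₂.symm.trans (degenerateRight_face_one _),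
    hs₂.edge₁₂.symm.trans hs₁r⟩

namespace Simplex

theorem ofCube_eq_const {N : Type*} {K : C(N → I, X)} {r : N → ℕ} {b : X} (l : N)
    (h : r l = 0 ∧ (∀ z, z l = 1 → K z = b) ∨ n < r l ∧ ∀ z, z l = 0 → K z = b) :
    (ofCube K r : Simplex n X) = ContinuousMap.const _ b := by
  ext x
  rw [ofCube_apply]
  obtain ⟨hl, hK⟩ | ⟨hl, hK⟩ := h
  · exact hK _ (by rw [hl, tailSum_zero])
  · exact hK _ (tailSum_of_lt hl x)

theorem cocycle_ofCube_sum {N : Type*} {c : Cochain 2 X} (hc : c ∈ cocycles 2 X)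
    (K : C(N → I, X)) {r r₀ r₁ r₂ r₃ : N → ℕ}
    (h₀ : ∀ l, (if 0 < r l then r l - 1 else r l) = r₀ l)
    (h₁ : ∀ l, (if 1 < r l then r l - 1 else r l) = r₁ l)
    (h₂ : ∀ l, (if 2 < r l then r l - 1 else r l) = r₂ l)
    (h₃ : ∀ l, (if 3 < r l then r l - 1 else r l) = r₃ l) :
    c (ofCube K r₀) - c (ofCube K r₁) + c (ofCube K r₂) - c (ofCube K r₃) = 0 := by
  have h := (isTetrahedron_faces (ofCube K r)).cocycle_sum hc
  rwa [face_ofCube h₀, face_ofCube h₁, face_ofCube h₂, face_ofCube h₃] at h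

/-- The six tetrahedra of the standard triangulation of the cube form a chain whose boundary is,
up to constant triangles, the difference of the two triangles of the bottom face. -/
theorem cocycle_ofCube_bottom {b : X} {K : C(Fin 3 → I, X)} (htop : ∀ z, z 0 = 1 → K z = b)
    (hside : ∀ z (l : Fin 2), z l.succ = 0 ∨ z l.succ = 1 → K z = b)
    {c : Cochain 2 X} (hc : c ∈ cocycles 2 X) :
    c (ofCube K ![3, 1, 2]) = c (ofCube K ![3, 2, 1]) := by
  have top (i j) : (ofCube K ![0, i, j] : Simplex 2 X) = ContinuousMap.const _ b :=
    ofCube_eq_const 0 (.inl ⟨rfl, htop⟩)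
  have right (i j) : (ofCube K ![i, 0, j] : Simplex 2 X) = ContinuousMap.const _ b :=
    ofCube_eq_const 1 (.inl ⟨rfl, fun z hz => hside z 0 (.inr hz)⟩)
  have left (i j) : (ofCube K ![i, 3, j] : Simplex 2 X) = ContinuousMap.const _ b :=
    ofCube_eq_const 1 (.inr ⟨by simp, fun z hz => hside z 0 (.inl hz)⟩)
  have back (i j) : (ofCube K ![i, j, 0] : Simplex 2 X) = ContinuousMap.const _ b :=
    ofCube_eq_const 2 (.inl ⟨rfl, fun z hz => hside z 1 (.inr hz)⟩)
  have front (i j) : (ofCube K ![i, j, 3] : Simplex 2 X) = ContinuousMap.const _ b :=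
    ofCube_eq_const 2 (.inr ⟨by simp, fun z hz => hside z 1 (.inl hz)⟩)
  have sum₁₂₃ := cocycle_ofCube_sum hc K (r := ![1, 2, 3]) (r₀ := ![0, 1, 2]) (r₁ := ![1, 1, 2])
    (r₂ := ![1, 2, 2]) (r₃ := ![1, 2, 3]) (by decide) (by decide) (by decide) (by decide)
  have sum₁₃₂ := cocycle_ofCube_sum hc K (r := ![1, 3, 2]) (r₀ := ![0, 2, 1]) (r₁ := ![1, 2, 1])
    (r₂ := ![1, 2, 2]) (r₃ := ![1, 3, 2]) (by decide) (by decide) (by decide) (by decide)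
  have sum₂₁₃ := cocycle_ofCube_sum hc K (r := ![2, 1, 3]) (r₀ := ![1, 0, 2]) (r₁ := ![1, 1, 2])
    (r₂ := ![2, 1, 2]) (r₃ := ![2, 1, 3]) (by decide) (by decide) (by decide) (by decide)
  have sum₂₃₁ := cocycle_ofCube_sum hc K (r := ![2, 3, 1]) (r₀ := ![1, 2, 0]) (r₁ := ![1, 2, 1])
    (r₂ := ![2, 2, 1]) (r₃ := ![2, 3, 1]) (by decide) (by decide) (by decide) (by decide)
  have sum₃₁₂ := cocycle_ofCube_sum hc K (r := ![3, 1, 2]) (r₀ := ![2, 0, 1]) (r₁ := ![2, 1, 1])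
    (r₂ := ![2, 1, 2]) (r₃ := ![3, 1, 2]) (by decide) (by decide) (by decide) (by decide)
  have sum₃₂₁ := cocycle_ofCube_sum hc K (r := ![3, 2, 1]) (r₀ := ![2, 1, 0]) (r₁ := ![2, 1, 1])
    (r₂ := ![2, 2, 1]) (r₃ := ![3, 2, 1]) (by decide) (by decide) (by decide) (by decide)
  rw [top, front] at sum₁₂₃
  rw [top, left] at sum₁₃₂
  rw [right, front] at sum₂₁₃
  rw [back, left] at sum₂₃₁
  rw [right] at sum₃₁₂
  rw [back] at sum₃₂₁
  linarith

end Simplex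

/-- The retraction of the square onto the triangle below its diagonal that is vertical above the
diagonal; it maps the boundary of the square to that of the triangle. -/
def squareToTriangle : C(Fin 2 → I, stdSimplex ℝ (Fin 3)) where
  toFun z := ⟨![1 - max (z 0 : ℝ) (z 1), max (z 0 : ℝ) (z 1) - z 1, z 1],
    by simp [Fin.forall_fin_succ, (z _).2.1, (z _).2.2], by simp [Fin.sum_univ_three]⟩
  continuous_toFun := by fun_prop

theorem coe_squareToTriangle (z : Fin 2 → I) :
    ⇑(squareToTriangle z) = ![1 - max (z 0 : ℝ) (z 1), max (z 0 : ℝ) (z 1) - z 1, z 1] :=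
  rfl

theorem squareToTriangle_tailSum (x : stdSimplex ℝ (Fin 3)) :
    squareToTriangle ![tailSum 1 x, tailSum 2 x] = x := by
  have hsum : x 0 + x 1 + x 2 = 1 := (Fin.sum_univ_three _).symm.trans (stdSimplex.sum_eq_one x)
  have hle : x 2 ≤ x 1 + x 2 := le_add_of_nonneg_left (stdSimplex.zero_le x 1)
  ext i
  fin_cases i <;>
    simp [coe_squareToTriangle, coe_tailSum, Finset.sum_filter, Fin.sum_univ_three, hle]
  linarith

theorem squareToTriangle_of_le {z : Fin 2 → I} (h : z 0 ≤ z 1) : squareToTriangle z 1 = 0 := by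
  have h' : (z 0 : ℝ) ≤ z 1 := h
  simp [coe_squareToTriangle, h']

theorem exists_squareToTriangle_eq_zero {z : Fin 2 → I} (hz : z ∈ Cube.boundary (Fin 2)) :
    ∃ i, squareToTriangle z i = 0 := by
  obtain (h | h) | (h | h) := Fin.exists_fin_two.1 hz
  · exact ⟨1, squareToTriangle_of_le (h.le.trans (z 1).2.1)⟩
  · exact ⟨0, by simp [coe_squareToTriangle, h, (z 1).2.2]⟩
  · exact ⟨2, congrArg Subtype.val h⟩
  · exact ⟨1, squareToTriangle_of_le (h ▸ (z 0).2.2)⟩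

theorem cocycle_of_face_eq_const {b : X} (hX : Subsingleton (HomotopyGroup.Pi 2 X b))
    {ω : Simplex 2 X} (hω : ∀ i, ω.face i = ContinuousMap.const _ b) {c : Cochain 2 X}
    (hc : c ∈ cocycles 2 X) : c ω = c (ContinuousMap.const _ b) := by
  have hω₀ (x : stdSimplex ℝ (Fin 3)) (i) (hx : x i = 0) : ω x = b := by
    obtain ⟨y, rfl⟩ := exists_stdSimplex_map_succAbove_eq hx
    exact DFunLike.congr_fun (hω i) y
  let g : GenLoop (Fin 2) X b := ⟨ω.comp squareToTriangle, fun z hz =>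
    (exists_squareToTriangle_eq_zero hz).elim (hω₀ _)⟩
  obtain ⟨H⟩ : GenLoop.Homotopic g GenLoop.const :=
    Quotient.exact (hX.elim (Quotient.mk _ g) (Quotient.mk _ GenLoop.const))
  let K : C(Fin 3 → I, X) :=
    H.toContinuousMap.comp ((ContinuousMap.eval 0).prodMk
      ⟨fun z l => z l.succ, continuous_pi fun l => continuous_apply l.succ⟩)
  have htop (z : Fin 3 → I) (hz : z 0 = 1) : K z = b := by
    change H (z 0, _) = b
    rw [hz, H.apply_one]
    rfl
  have hside (z : Fin 3 → I) (l : Fin 2) (hz : z l.succ = 0 ∨ z l.succ = 1) : K z = b :=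
    H.eq_snd (z 0) ⟨l, hz⟩
  have hbottom (i j : ℕ) (x : stdSimplex ℝ (Fin 3)) :
      ofCube K ![3, i, j] x = ω (squareToTriangle ![tailSum i x, tailSum j x]) := by
    change H (tailSum 3 x, _) = _
    rw [tailSum_of_lt (by decide), H.apply_zero]
    refine congrArg (ω.comp squareToTriangle) (funext fun l => ?_)
    fin_cases l <;> rfl
  have hlower : ofCube K ![3, 1, 2] = ω := ContinuousMap.ext fun x =>
    (hbottom 1 2 x).trans (congrArg ω (squareToTriangle_tailSum x))
  have hupper : ofCube K ![3, 2, 1] = ContinuousMap.const _ b := ContinuousMap.ext fun x =>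
    (hbottom 2 1 x).trans (hω₀ _ 1 (squareToTriangle_of_le (antitone_tailSum x one_le_two)))
  rw [← hlower, cocycle_ofCube_bottom htop hside hc, hupper]

theorem cocycle_eq_of_face_eq {b : X} (hX : Subsingleton (HomotopyGroup.Pi 2 X b))
    {τ τ' : Simplex 2 X} (hface : ∀ i, τ.face i = τ'.face i) (hb : τ (stdSimplex.vertex 2) = b)
    {c : Cochain 2 X} (hc : c ∈ cocycles 2 X) : c τ = c τ' := by
  have h₀ : τ.face 0 (stdSimplex.vertex 1) = b := (τ.face_vertex 0 1).trans hb
  have h₁ : τ.face 1 (stdSimplex.vertex 1) = b := (τ.face_vertex 1 1).trans hb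
  obtain ⟨ρ, hρ⟩ := exists_isTetrahedron₁ (s₀ := (τ.face 0).degenerateRight) (s₂ := τ') (s₃ := τ)
    ((degenerateRight_face_one _).trans (hface 0)) (degenerateRight_face_two _) (hface 2).symm
  obtain ⟨ω, hω⟩ := exists_isTetrahedron₀ (s₁ := ρ) (s₂ := (τ.face 1).degenerateRight)
    (s₃ := (τ.face 1).degenerateRight)
    (by rw [hρ.edge₁₂, degenerateRight_face_one, hface])
    (by rw [hρ.edge₁₃, degenerateRight_face_one]) rfl
  have hω_const (i) : ω.face i = ContinuousMap.const _ b := by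
    fin_cases i
    · exact hω.edge₀₁.trans (hρ.edge₀₁.symm.trans (by rw [degenerateRight_face_zero, h₀]))
    · exact hω.edge₀₂.trans (by rw [degenerateRight_face_zero, h₁])
    · exact hω.edge₀₃.trans (by rw [degenerateRight_face_zero, h₁])
  have hρ_sum := hρ.cocycle_sum hc
  have hω_sum := hω.cocycle_sum hc
  rw [cocycle_degenerateRight hc, h₀] at hρ_sum
  rw [cocycle_of_face_eq_const hX hω_const hc] at hω_sum
  linarith

end Simplices

section Injectivity

open Simplex

variable {M B : Type*} [TopologicalSpace M] [TopologicalSpace B] {f : C(M, B)} {x₀ : M}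
  {P : ∀ y, Path y (f x₀)}

variable (P) in
/-- The square, cut along a diagonal into a lower and an upper triangle, through which an edge `e`
is pushed along the paths `P` at its ends onto the image of a loop in `M`. -/
structure LoopPrism (e : Simplex 1 B) where
  loop : Path x₀ x₀
  lower : Simplex 2 B
  upper : Simplex 2 B
  lower_two : lower.face 2 = e
  lower_zero : lower.face 0 = pathSimplex (P (e (stdSimplex.vertex 1)))
  diagonal : upper.face 1 = lower.face 1
  upper_two : upper.face 2 = pathSimplex (P (e (stdSimplex.vertex 0)))
  upper_zero : upper.face 0 = f.comp (pathSimplex loop)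

variable (P) in
theorem nonempty_loopPrism
    (hf : ∀ g : Path (f x₀) (f x₀), ∃ γ : Path x₀ x₀, (γ.map f.continuous).Homotopic g)
    (e : Simplex 1 B) : Nonempty (LoopPrism P e) := by
  obtain ⟨p, hp⟩ := exists_pathSimplex_eq (e := e) rfl rfl
  let q := P (e (stdSimplex.vertex 0))
  let r := p.trans (P (e (stdSimplex.vertex 1)))
  obtain ⟨γ, hγ⟩ := hf (q.symm.trans r)
  have hqr : (q.trans (γ.map f.continuous)).Homotopic r := by
    refine ((Path.Homotopic.refl q).hcomp hγ).trans (Path.Homotopic.Quotient.exact ?_)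
    simp only [Path.Homotopic.Quotient.mk_trans, Path.Homotopic.Quotient.mk_symm,
      ← Path.Homotopic.Quotient.trans_assoc, Path.Homotopic.Quotient.trans_symm,
      Path.Homotopic.Quotient.refl_trans]
  obtain ⟨T, hT₂, hT₀, hT₁⟩ := homotopic_trans_iff.1 (Path.Homotopic.refl r)
  obtain ⟨S, hS₂, hS₀, hS₁⟩ := homotopic_trans_iff.1 hqr
  exact ⟨⟨γ, T, S, hT₂.trans hp, hT₀, hS₁.trans hT₁.symm, hS₂, hS₀⟩⟩

/-- The tetrahedra are the standard triangulation of a prism over `τ` whose sides are the three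
squares; each is filled from one of its horns, and `E` is the far end of the prism. -/
theorem exists_cocycle_eq_sum_loopPrism (prism : ∀ e, LoopPrism P e) (τ : Simplex 2 B) :
    ∃ E : Simplex 2 B, (∀ i, E.face i = f.comp (pathSimplex (prism (τ.face i)).loop)) ∧
      ∀ c ∈ cocycles 2 B, c τ =
        ∑ i : Fin 3, (-1) ^ (i : ℕ) * (c (prism (τ.face i)).lower - c (prism (τ.face i)).upper) +
          c E := by
  let Q (i : Fin 3) := prism (τ.face i)
  obtain ⟨X, hX⟩ := exists_isTetrahedron₂ (s₀ := (Q 0).lower) (s₁ := (Q 1).lower) (s₃ := τ)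
    (by rw [(Q 0).lower_zero, (Q 1).lower_zero, τ.face_vertex, τ.face_vertex]; rfl)
    (Q 0).lower_two (Q 1).lower_two
  obtain ⟨Y, hY⟩ := exists_isTetrahedron₁ (s₀ := (Q 0).upper) (s₂ := X) (s₃ := (Q 2).lower)
    ((Q 0).diagonal.trans hX.edge₀₂)
    (by rw [(Q 0).upper_two, (Q 2).lower_zero, τ.face_vertex, τ.face_vertex]; rfl)
    (hX.edge₂₃.trans (Q 2).lower_two.symm)
  obtain ⟨E, hE⟩ := exists_isTetrahedron₀ (s₁ := Y) (s₂ := (Q 1).upper) (s₃ := (Q 2).upper)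
    (by rw [hY.edge₁₂, ← hX.edge₁₂, (Q 1).diagonal]) (hY.edge₁₃.trans (Q 2).diagonal.symm)
    (by rw [(Q 1).upper_two, (Q 2).upper_two, τ.face_vertex, τ.face_vertex]; rfl)
  refine ⟨E, fun i => ?_, fun c hc => ?_⟩
  · fin_cases i
    · exact hE.edge₀₁.trans (hY.edge₀₁.symm.trans (Q 0).upper_zero)
    · exact hE.edge₀₂.trans (Q 1).upper_zero
    · exact hE.edge₀₃.trans (Q 2).upper_zero
  · have hX_sum := hX.cocycle_sum hc
    have hY_sum := hY.cocycle_sum hc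
    have hE_sum := hE.cocycle_sum hc
    change c τ = ∑ i : Fin 3, (-1) ^ (i : ℕ) * (c (Q i).lower - c (Q i).upper) + c E
    rw [Fin.sum_univ_three]
    simp only [Fin.val_zero, Fin.val_one, Fin.val_two, pow_zero, pow_one, one_mul, neg_mul,
      neg_one_sq]
    linarith

theorem exists_simplex_face_eq_of_comp
    (hf : ∀ γ γ' : Path x₀ x₀, (γ.map f.continuous).Homotopic (γ'.map f.continuous) →
      γ.Homotopic γ')
    {E : Simplex 2 B} {γ : Fin 3 → Path x₀ x₀} (hE : ∀ i, E.face i = f.comp (pathSimplex (γ i))) :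
    ∃ D : Simplex 2 M, ∀ i, D.face i = pathSimplex (γ i) := by
  have h : (((γ 2).map f.continuous).trans ((γ 0).map f.continuous)).Homotopic
      ((γ 1).map f.continuous) := homotopic_trans_iff.2 ⟨E, hE 2, hE 0, hE 1⟩
  rw [← Path.map_trans] at h
  obtain ⟨D, hD₂, hD₀, hD₁⟩ := homotopic_trans_iff.1 (hf _ _ h)
  exact ⟨D, Fin.forall_fin_succ.2 ⟨hD₀, Fin.forall_fin_two.2 ⟨hD₁, hD₂⟩⟩⟩

theorem exists_coboundary_eq [PathConnectedSpace B]
    (hB : Subsingleton (HomotopyGroup.Pi 2 B (f x₀)))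
    (hsurj : ∀ g : Path (f x₀) (f x₀), ∃ γ : Path x₀ x₀, (γ.map f.continuous).Homotopic g)
    (hinj : ∀ γ γ' : Path x₀ x₀, (γ.map f.continuous).Homotopic (γ'.map f.continuous) →
      γ.Homotopic γ')
    {c : Cochain 2 B} (hc : c ∈ cocycles 2 B) {b : Cochain 1 M}
    (hb : coboundary 1 M b = cochainMap 2 f c) : ∃ b', coboundary 1 B b' = c := by
  let P (y : B) : Path y (f x₀) := (PathConnectedSpace.joined y (f x₀)).somePath
  let prism (e : Simplex 1 B) : LoopPrism P e := (nonempty_loopPrism P hsurj e).some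
  let b' : Cochain 1 B := fun e =>
    c (prism e).lower - c (prism e).upper + b (pathSimplex (prism e).loop)
  refine ⟨b', funext fun τ => ?_⟩
  obtain ⟨E, hE, hτ⟩ := exists_cocycle_eq_sum_loopPrism prism τ
  obtain ⟨D, hD⟩ := exists_simplex_face_eq_of_comp hinj hE
  have hED : c E = c (f.comp D) := by
    refine cocycle_eq_of_face_eq hB (fun i => ?_) ?_ hc
    · exact (hE i).trans (congrArg f.comp (hD i)).symm
    · exact (E.face_vertex 0 1).symm.trans ((congrArg (· (stdSimplex.vertex 1)) (hE 0)).trans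
        (congrArg f (pathSimplex_vertex_one _)))
  have hbD : ∑ i : Fin 3, (-1) ^ (i : ℕ) * b (D.face i) = c (f.comp D) := congrFun hb D
  simp only [hD] at hbD
  change ∑ i : Fin 3, (-1) ^ (i : ℕ) * b' (τ.face i) = c τ
  rw [hτ c hc, hED, ← hbD, ← Finset.sum_add_distrib]
  exact Finset.sum_congr rfl fun _ _ => mul_add _ _ _

theorem cohomology_map_two_injective [PathConnectedSpace B] {b : B} (h : f x₀ = b)
    (hB : Subsingleton (HomotopyGroup.Pi 2 B b))
    (hf : Function.Bijective (FundamentalGroup.mapOfEq f h)) :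
    Function.Injective (Cohomology.map 2 f) := by
  subst h
  have hmk (γ : Path x₀ x₀) : FundamentalGroup.mapOfEq f rfl
      (FundamentalGroup.fromPath (Path.Homotopic.Quotient.mk γ)) =
      Path.Homotopic.Quotient.mk (γ.map f.continuous) := by
    rw [FundamentalGroup.mapOfEq_apply, Path.Homotopic.Quotient.cast_rfl_rfl]
    rfl
  have hsurj (g : Path (f x₀) (f x₀)) :
      ∃ γ : Path x₀ x₀, (γ.map f.continuous).Homotopic g := by
    obtain ⟨q, hq⟩ := hf.2 (FundamentalGroup.fromPath (Path.Homotopic.Quotient.mk g))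
    obtain ⟨γ, rfl⟩ := Path.Homotopic.Quotient.mk_surjective q
    exact ⟨γ, Path.Homotopic.Quotient.exact ((hmk γ).symm.trans hq)⟩
  have hinj (γ γ' : Path x₀ x₀)
      (hγ : (γ.map f.continuous).Homotopic (γ'.map f.continuous)) : γ.Homotopic γ' :=
    Path.Homotopic.Quotient.exact (hf.1 ((hmk γ).trans
      ((Path.Homotopic.Quotient.eq.2 hγ).trans (hmk γ').symm)))
  rw [← LinearMap.ker_eq_bot, LinearMap.ker_eq_bot']
  intro x hx
  obtain ⟨c, rfl⟩ := Submodule.Quotient.mk_surjective _ x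
  obtain ⟨d, hd⟩ := (Submodule.Quotient.mk_eq_zero _).1 hx
  exact (Submodule.Quotient.mk_eq_zero _).2 (exists_coboundary_eq hB hsurj hinj c.2 hd)

end Injectivity

section Forms

variable {U V : Type*} [AddCommGroup U] [AddCommGroup V]

theorem realForm_baseChange (F : V →ₗ[ℤ] V →ₗ[ℤ] ℤ) (g : U →ₗ[ℤ] V) (x y : ℝ ⊗[ℤ] U) :
    realForm F (g.baseChange ℝ x) (g.baseChange ℝ y) = realForm (F.compl₁₂ g g) x y := by
  suffices h : (realForm F).compl₁₂ (g.baseChange ℝ) (g.baseChange ℝ) =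
      realForm (F.compl₁₂ g g) from LinearMap.congr_fun₂ h x y
  ext u v
  simp [realForm]

theorem bPlus_compl₁₂_le (F : V →ₗ[ℤ] V →ₗ[ℤ] ℤ) {g : U →ₗ[ℤ] V} (hg : Function.Injective g) :
    bPlus (F.compl₁₂ g g) ≤ bPlus F := by
  have hinj : Function.Injective (g.baseChange ℝ) :=
    Module.Flat.lTensor_preserves_injective_linearMap g hg
  refine iSup₂_le fun W hW => ?_
  have hrank := congrArg Cardinal.toENat (Submodule.equivMapOfInjective _ hinj W).lift_rank_eq
  rw [Cardinal.toENat_lift, Cardinal.toENat_lift] at hrank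
  refine le_iSup₂_of_le (W.map (g.baseChange ℝ)) ?_ hrank.le
  rintro _ ⟨w, hw, rfl⟩ hne
  rw [realForm_baseChange]
  exact hW w hw fun h => hne (by rw [h, map_zero])

theorem realForm_neg (F : V →ₗ[ℤ] V →ₗ[ℤ] ℤ) : realForm (-F) = -realForm F := by
  ext
  simp [realForm]

theorem bPlus_neg (F : V →ₗ[ℤ] V →ₗ[ℤ] ℤ) : bPlus (-F) = bMinus F := by
  simp only [bPlus, bMinus, realForm_neg, LinearMap.neg_apply, Left.neg_pos_iff]

theorem bMinus_compl₁₂_le (F : V →ₗ[ℤ] V →ₗ[ℤ] ℤ) {g : U →ₗ[ℤ] V} (hg : Function.Injective g) :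
    bMinus (F.compl₁₂ g g) ≤ bMinus F := by
  rw [← bPlus_neg, ← bPlus_neg]
  exact bPlus_compl₁₂_le (-F) hg

theorem IsIsotropic.map {F : V →ₗ[ℤ] V →ₗ[ℤ] ℤ} {g : U →ₗ[ℤ] V} {W : Submodule ℤ U}
    (h : IsIsotropic (F.compl₁₂ g g) W) : IsIsotropic F (W.map g) := by
  rintro _ ⟨x, hx, rfl⟩ _ ⟨y, hy, rfl⟩
  exact h x hx y hy

theorem IsEvenForm.restrictForm_range {F : V →ₗ[ℤ] V →ₗ[ℤ] ℤ} {g : U →ₗ[ℤ] V}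
    (h : IsEvenForm (F.compl₁₂ g g)) : IsEvenForm (restrictForm F (LinearMap.range g)) := by
  rintro ⟨_, x, rfl⟩
  exact h x

theorem ker_mkQ_torsion_comp {g : U →ₗ[ℤ] V} (hg : Function.Injective g) :
    LinearMap.ker ((Submodule.torsion ℤ V).mkQ ∘ₗ g) = Submodule.torsion ℤ U := by
  ext x
  rw [LinearMap.mem_ker, LinearMap.comp_apply, Submodule.mkQ_apply,
    Submodule.Quotient.mk_eq_zero]
  refine exists_congr fun a => ?_
  change (a : ℤ) • g x = 0 ↔ (a : ℤ) • x = 0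
  rw [← map_smul, map_eq_zero_iff g hg]

end Forms

section Naturality

variable {X Y : Type*} [TopologicalSpace X] [TopologicalSpace Y]

theorem evalChain_cochainMap (n : ℕ) (f : C(X, Y)) (c : Cochain n Y) (d : Chain n X) :
    evalChain (cochainMap n f c) d = evalChain c (chainMap n f d) := by
  suffices h : evalChain (cochainMap n f c) = evalChain c ∘ₗ chainMap n f from
    LinearMap.congr_fun h d
  refine Finsupp.lhom_ext fun s k => ?_
  simp [evalChain, chainMap, cochainMap, LinearMap.funLeft]

theorem capEval_map (n : ℕ) (f : C(X, Y)) (x : Cohomology n Y) (a : Homology n X) :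
    capEval n (Cohomology.map n f x) a = capEval n x (Homology.map n f a) := by
  obtain ⟨c, rfl⟩ := Submodule.Quotient.mk_surjective _ x
  obtain ⟨d, rfl⟩ := Submodule.Quotient.mk_surjective _ a
  exact evalChain_cochainMap n f c.1 d.1

theorem cup_map (p q : ℕ) (f : C(X, Y)) (x : Cohomology p Y) (y : Cohomology q Y) :
    cup p q (Cohomology.map p f x) (Cohomology.map q f y) =
      Cohomology.map (p + q) f (cup p q x y) := by
  obtain ⟨c, rfl⟩ := Submodule.Quotient.mk_surjective _ x
  obtain ⟨d, rfl⟩ := Submodule.Quotient.mk_surjective _ y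
  rfl

theorem cupPairing_map (f : C(X, Y)) (a : Homology 4 X) (x y : Cohomology 2 Y) :
    cupPairing a (Cohomology.map 2 f x) (Cohomology.map 2 f y) =
      cupPairing (Homology.map 4 f a) x y := by
  change capEval 4 (cup 2 2 _ _) a = capEval 4 (cup 2 2 x y) _
  rw [cup_map, capEval_map]

theorem intersectionForm_compl₁₂_pullbackModTorsion (f : C(X, Y)) (a : Homology 4 X) :
    (intersectionForm a).compl₁₂ (pullbackModTorsion f) (pullbackModTorsion f) =
      cupPairing (Homology.map 4 f a) :=
  LinearMap.ext₂ (cupPairing_map f a)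

/-- The isomorphism of `H²(Y) / torsion` onto `I(X, f)` induced by an injective `f^*`. -/
def modTorsionEquivImageI (f : C(X, Y)) (hf : Function.Injective (Cohomology.map 2 f)) :
    ModTorsion (Cohomology 2 Y) ≃ₗ[ℤ] imageI f :=
  (Submodule.quotEquivOfEq _ _ (ker_mkQ_torsion_comp hf).symm).trans
    (pullbackModTorsion f).quotKerEquivRange

theorem coe_modTorsionEquivImageI_mk (f : C(X, Y))
    (hf : Function.Injective (Cohomology.map 2 f)) (x : Cohomology 2 Y) :
    (modTorsionEquivImageI f hf (Submodule.Quotient.mk x) : ModTorsion (Cohomology 2 X)) =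
      pullbackModTorsion f x :=
  rfl

theorem intersectionForm_modTorsionEquivImageI (f : C(X, Y))
    (hf : Function.Injective (Cohomology.map 2 f)) (a : Homology 4 X)
    (x y : ModTorsion (Cohomology 2 Y)) :
    intersectionForm a (modTorsionEquivImageI f hf x) (modTorsionEquivImageI f hf y) =
      formModTorsion (cupPairing (Homology.map 4 f a)) x y := by
  obtain ⟨x, rfl⟩ := Submodule.Quotient.mk_surjective _ x
  obtain ⟨y, rfl⟩ := Submodule.Quotient.mk_surjective _ y
  exact cupPairing_map f a x y

theorem imageI_eq_top {f : C(X, Y)} (hf : Function.Surjective (Cohomology.map 2 f)) :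
    imageI f = ⊤ :=
  LinearMap.range_eq_top.2 ((Submodule.mkQ_surjective _).comp hf)

end Naturality

section CWComplex

open Topology

variable {X : Type*} [TopologicalSpace X] [T2Space X] [CWComplex (univ : Set X)]

theorem isClosed_of_joined_of_cwComplex {A : Set X} (hA : ∀ y ∈ A, ∀ z, Joined y z → z ∈ A) :
    IsClosed A := by
  rw [CWComplex.closed univ A (subset_univ A)]
  intro n j
  obtain hempty | ⟨y, hyA, hy⟩ := (A ∩ RelCWComplex.closedCell n j).eq_empty_or_nonempty
  · rw [hempty]
    exact isClosed_empty
  · have hpath : IsPathConnected (RelCWComplex.closedCell (C := (univ : Set X)) n j) :=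
      ((convex_closedBall (0 : Fin n → ℝ) 1).isPathConnected
        ⟨0, Metric.mem_closedBall_self zero_le_one⟩).image' (RelCWComplex.continuousOn n j)
    have hsub : RelCWComplex.closedCell n j ⊆ A := fun z hz =>
      hA y hyA z (hpath.joinedIn y hy z hz).joined
    rw [inter_eq_right.2 hsub]
    exact RelCWComplex.isClosed_closedCell

theorem pathConnectedSpace_of_cwComplex [ConnectedSpace X] : PathConnectedSpace X := by
  refine ⟨inferInstance, fun x y => ?_⟩
  have hclopen : IsClopen (pathComponent x) := by
    refine ⟨isClosed_of_joined_of_cwComplex fun y hy z hyz => hy.trans hyz, ?_⟩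
    rw [← isClosed_compl_iff]
    exact isClosed_of_joined_of_cwComplex fun y hy z hyz hz => hy (Joined.trans hz hyz.symm)
  have huniv := hclopen.eq_univ ⟨x, mem_pathComponent_self x⟩
  exact huniv.ge (mem_univ y)

end CWComplex

section EilenbergMacLane

variable {G B : Type*} [Group G] [TopologicalSpace B]

theorem EilenbergMacLane.pathConnectedSpace (K : EilenbergMacLane G B) : PathConnectedSpace B := by
  have := K.t2
  have := K.connected
  obtain ⟨_⟩ := K.cw
  exact pathConnectedSpace_of_cwComplex

theorem MemM.bijective_mapOfEq {M : Type*} [TopologicalSpace M] {K : EilenbergMacLane G B}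
    {α : Homology 4 B} {c : Homology 4 M} {x₀ : M} {φ : FundamentalGroup M x₀ ≃* G} {f : C(M, B)}
    (hM : MemM K α c φ f) : Function.Bijective (FundamentalGroup.mapOfEq f hM.based) := by
  have hφ : K.iso ∘ FundamentalGroup.mapOfEq f hM.based = φ := funext hM.induces
  rw [← K.iso.bijective.of_comp_iff', hφ]
  exact φ.bijective

end EilenbergMacLane

end GroupGeography

end

open GroupGeography in
theorem mainTheorem2_general
    {M B : Type*} [TopologicalSpace M] [TopologicalSpace B] [PathConnectedSpace B]
    {f : C(M, B)} {x₀ : M} {b : B} (h : f x₀ = b)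
    (hB : Subsingleton (HomotopyGroup.Pi 2 B b))
    (hf : Function.Bijective (FundamentalGroup.mapOfEq f h))
    {c : Homology 4 M} {α : Homology 4 B} (hα : Homology.map 4 f c = α) :
    Function.Injective (Cohomology.map 2 f) ∧
    (∀ x y : Cohomology 2 B,
      intersectionForm c (pullbackModTorsion f x) (pullbackModTorsion f y) = cupPairing α x y) ∧
    (∃ e : ModTorsion (Cohomology 2 B) ≃ₗ[ℤ] imageI f,
      (∀ x : Cohomology 2 B,
        (e (Submodule.Quotient.mk x) : ModTorsion (Cohomology 2 M)) = pullbackModTorsion f x) ∧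
      ∀ x y, restrictForm (intersectionForm c) (imageI f) (e x) (e y) =
        formModTorsion (cupPairing α) x y) ∧
    (bPlus (restrictForm (intersectionForm c) (imageI f)) ≤ bPlus (intersectionForm c) ∧
      bMinus (restrictForm (intersectionForm c) (imageI f)) ≤ bMinus (intersectionForm c)) ∧
    (∀ W : Submodule ℤ (Cohomology 2 B), IsIsotropic (cupPairing α) W →
      IsIsotropic (intersectionForm c) (W.map (pullbackModTorsion f))) ∧
    (IsEvenForm (cupPairing α) →
      IsEvenForm (restrictForm (intersectionForm c) (imageI f))) ∧
    (imageI f = ⊤ → ∃ e : ModTorsion (Cohomology 2 B) ≃ₗ[ℤ] ModTorsion (Cohomology 2 M),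
      (∀ x : Cohomology 2 B, e (Submodule.Quotient.mk x) = pullbackModTorsion f x) ∧
      ∀ x y, intersectionForm c (e x) (e y) = formModTorsion (cupPairing α) x y) ∧
    (Function.Surjective (Cohomology.map 2 f) → imageI f = ⊤) := by
  subst hα
  have hinj := cohomology_map_two_injective h hB hf
  have hpullback := intersectionForm_compl₁₂_pullbackModTorsion f c
  have hiso := intersectionForm_modTorsionEquivImageI f hinj c
  refine ⟨hinj, LinearMap.congr_fun₂ hpullback,
    ⟨modTorsionEquivImageI f hinj, coe_modTorsionEquivImageI_mk f hinj, hiso⟩,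
    ⟨bPlus_compl₁₂_le _ (imageI f).injective_subtype,
      bMinus_compl₁₂_le _ (imageI f).injective_subtype⟩,
    fun W hW => ?isotropic, fun heven => ?even, fun htop => ?iso, imageI_eq_top⟩
  case isotropic =>
    rw [← hpullback] at hW
    exact hW.map
  case even =>
    rw [← hpullback] at heven
    exact heven.restrictForm_range
  case iso =>
    exact ⟨(modTorsionEquivImageI f hinj).trans (LinearEquiv.ofTop _ htop),
      coe_modTorsionEquivImageI_mk f hinj, hiso⟩

open GroupGeography in
theorem mainTheorem2
    {G : Type*} [Group G] {B : Type*} [TopologicalSpace B] (K : EilenbergMacLane G B)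
    (α : Homology 4 B)
    {M : Type*} [TopologicalSpace M] [T2Space M] [CompactSpace M] [ConnectedSpace M]
    [ChartedSpace (EuclideanSpace ℝ (Fin 4)) M]
    (c : Homology 4 M) {x₀ : M} (φ : FundamentalGroup M x₀ ≃* G) (f : C(M, B))
    (hM : MemM K α c φ f) :
    Function.Injective (Cohomology.map 2 f) ∧
    (∀ x y : Cohomology 2 B,
      intersectionForm c (pullbackModTorsion f x) (pullbackModTorsion f y) = cupPairing α x y) ∧
    (∃ e : ModTorsion (Cohomology 2 B) ≃ₗ[ℤ] imageI f,
      (∀ x : Cohomology 2 B,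
        (e (Submodule.Quotient.mk x) : ModTorsion (Cohomology 2 M)) = pullbackModTorsion f x) ∧
      ∀ x y, restrictForm (intersectionForm c) (imageI f) (e x) (e y) =
        formModTorsion (cupPairing α) x y) ∧
    (bPlus (restrictForm (intersectionForm c) (imageI f)) ≤ bPlus (intersectionForm c) ∧
      bMinus (restrictForm (intersectionForm c) (imageI f)) ≤ bMinus (intersectionForm c)) ∧
    (∀ W : Submodule ℤ (Cohomology 2 B), IsIsotropic (cupPairing α) W →
      IsIsotropic (intersectionForm c) (W.map (pullbackModTorsion f))) ∧
    (IsEvenForm (cupPairing α) →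
      IsEvenForm (restrictForm (intersectionForm c) (imageI f))) ∧
    (imageI f = ⊤ → ∃ e : ModTorsion (Cohomology 2 B) ≃ₗ[ℤ] ModTorsion (Cohomology 2 M),
      (∀ x : Cohomology 2 B, e (Submodule.Quotient.mk x) = pullbackModTorsion f x) ∧
      ∀ x y, intersectionForm c (e x) (e y) = formModTorsion (cupPairing α) x y) ∧
    (Function.Surjective (Cohomology.map 2 f) → imageI f = ⊤) := by
  have := K.pathConnectedSpace
  exact mainTheorem2_general hM.based (K.aspherical 2 le_rfl) hM.bijective_mapOfEq hM.map_class
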